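/- Let $1\le \nu<n$, $J=\operatorname{diag}(I_\nu,-I_{n-\nu})$, and let $A\in\mathbb{C}^{n\times n}$ be Hermitian positive definite. **Pivot orderings.** Let $\mathcal P_n=\{(r,s): 1\le r<s\le n\}$. A *pivot ordering* is a finite sequence in which every element of $\mathcal P_n$ appears exactly once. Two pivot orderings are *equivalent* if one is obtained from the other by finitely many transpositions of adjacent terms $(i,j),(i',j')$ with $\{i,j\}\cap\{i',j'\}=\emptyset$. They are *shift-equivalent* if they have the forms $[\mathcal O_1,\mathcal O_2]$ and $[\mathcal O_2,\mathcal O_1]$ (concatenations). They are *weakly equivalent* if they are joined by a finite chain in which neighbours are equivalent or shift-equivalent. They are *permutation equivalent* if one arises from the other by replacing each term $(i,j)$ by $(\mathsf q(i),\mathsf q(j))$ for one permutation $\mathsf q$ of $\{1,\dots,n\}$, the smaller index being written first. A *serial ordering with permutations* is a pivot ordering that either lists the columns $2,3,\dots,n$ of the strictly upper triangle one after another, or lists its rows $n-1,n-2,\dots,1$ one after another, with the positions inside each column (row) in arbitrary order, or the reverse of such an ordering. A pivot ordering $\mathcal O$ is *generalized serial* if there are pivot orderings $\mathcal O',\mathcal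 O''$, with $\mathcal O''$ a serial ordering with permutations, such that either $\mathcal O$ is permutation equivalent to $\mathcal O'$ and $\mathcal O'$ weakly equivalent to $\mathcal O''$, or $\mathcal O$ is weakly equivalent to $\mathcal O'$ and $\mathcal O'$ permutation equivalent to $\mathcal O''$. **The method.** Let $\mathcal O=(i_0,j_0),\dots,(i_{M-1},j_{M-1})$, $M=n(n-1)/2$, be a pivot ordering. The element-wise complex $J$-Jacobi method under the cyclic strategy defined by $\mathcal O$ generates $A^{(0)}=A$, $A^{(k+1)}=(T^{(k)})^*A^{(k)}T^{(k)}$, where, with $(i,j)=(i_{k\bmod M},j_{k\bmod M})$, the matrix $T^{(k)}$ agrees with $I_n$ except in the rows and columns $i,j$, where it has the $2\times2$ submatrix $\widehat T=\operatorname{diag}(e^{\imath\phi},1)\,\widehat R$. Here, writing $a_{rs}$ for the elements of $A^{(k)}$, $\phi$ is an argument of $a_{ij}$, and $$\widehat R=\begin{bmatrix}\cosh\theta&\sinh\theta\\ \sinh\theta&\cosh\theta\end{bmatrix},\quad \tanh 2\theta=\frac{-2|a_{ij}|}{a_{ii}+a_{jj}},\qquad\text{if } i\le\nu<j,$$ $$\widehat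 R=\begin{bmatrix}\cos\theta&-\sin\theta\\ \sin\theta&\cos\theta\end{bmatrix},\quad \tan 2\theta=\frac{2|a_{ij}|}{a_{ii}-a_{jj}},\quad -\frac{\pi}{4}\le\theta\le\frac{\pi}{4},\qquad\text{otherwise.}$$ The equation for $\tan2\theta$ is read as $2|a_{ij}|\cos2\theta=(a_{ii}-a_{jj})\sin2\theta$. Where these conditions leave $\phi$ or $\theta$ undetermined (an argument of $0$; $a_{ii}=a_{jj}$), any choice may be made at each step. **Theorem.** If $\mathcal O$ is generalized serial, then the method is globally convergent: for every Hermitian positive definite $A$, every sequence $(A^{(k)})_{k\ge0}$ generated by the method from $A$ converges to a diagonal matrix $\Lambda=\operatorname{diag}(\lambda_1,\dots,\lambda_n)$ with real $\lambda_r$, which is the diagonal matrix of the eigenvalues of the pair $(A,J)$ in the sense that $\det(A-xJ)=\prod_{r=1}^n(\lambda_r-xJ_{rr})$ for all $x\in\mathbb C$ (that is, the eigenvalues of $Ax=\lambda Jx$, with multiplicities, are the numbers $J_{rr}\lambda_r$). -/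

import Mathlib

open Matrix Filter Topology
open scoped ComplexOrder

namespace JJacobi

/-! ## Pivot orderings (indices `1, …, n` of the matrix are `0, …, n - 1` here) -/

/-- A pivot ordering: a finite sequence in which every pivot position `(r, s)`, `r < s`,
appears exactly once, and nothing else appears. -/
def IsPivotOrdering {n : ℕ} (O : List (Fin n × Fin n)) : Prop :=
  O.Nodup ∧ ∀ p : Fin n × Fin n, p ∈ O ↔ p.1 < p.2

/-- Interchange of two adjacent terms whose index sets are disjoint. -/
inductive AdmissibleTransposition {n : ℕ} :
    List (Fin n × Fin n) → List (Fin n × Fin n) → Prop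
  | swap (l₁ l₂ : List (Fin n × Fin n)) (p q : Fin n × Fin n)
      (h : Disjoint ({p.1, p.2} : Set (Fin n)) {q.1, q.2}) :
      AdmissibleTransposition (l₁ ++ p :: q :: l₂) (l₁ ++ q :: p :: l₂)

/-- Equivalence: a finite number of admissible transpositions. -/
def Equivalent {n : ℕ} (O O' : List (Fin n × Fin n)) : Prop :=
  Relation.ReflTransGen AdmissibleTransposition O O'

/-- Shift-equivalence: `O = [O₁, O₂]` and `O' = [O₂, O₁]`. -/
def ShiftEquivalent {n : ℕ} (O O' : List (Fin n × Fin n)) : Prop :=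
  ∃ O₁ O₂ : List (Fin n × Fin n), O = O₁ ++ O₂ ∧ O' = O₂ ++ O₁

/-- Weak equivalence: a finite chain of equivalences and shift-equivalences. -/
def WeakEquivalent {n : ℕ} (O O' : List (Fin n × Fin n)) : Prop :=
  Relation.ReflTransGen (fun P Q => Equivalent P Q ∨ ShiftEquivalent P Q) O O'

/-- Permutation equivalence: relabel all indices by a permutation `q`. The position
`(q i, q j)` is written with its smaller index first, so that it is a pivot position again. -/
def PermutationEquivalent {n : ℕ} (O O' : List (Fin n × Fin n)) : Prop :=
  ∃ q : Equiv.Perm (Fin n),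
    O' = O.map (fun p => (min (q p.1) (q p.2), max (q p.1) (q p.2)))

/-- Column by column, from left to right; `τ j` lists the rows `i < j` in any order. -/
def IsColumnSerial {n : ℕ} (O : List (Fin n × Fin n)) : Prop :=
  ∃ τ : Fin n → List (Fin n), (∀ j, (τ j).Nodup ∧ ∀ i, i ∈ τ j ↔ i < j) ∧
    O = (List.finRange n).flatMap (fun j => (τ j).map (fun i => (i, j)))

/-- Row by row, from the bottom to the top; `τ i` lists the columns `j > i` in any order. -/
def IsRowSerial {n : ℕ} (O : List (Fin n × Fin n)) : Prop :=
  ∃ τ : Fin n → List (Fin n), (∀ i, (τ i).Nodup ∧ ∀ j, j ∈ τ i ↔ i < j) ∧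
    O = (List.finRange n).reverse.flatMap (fun i => (τ i).map (fun j => (i, j)))

/-- Serial pivot orderings with permutations: the two classes above and their reverses. -/
def IsSerialWithPermutations {n : ℕ} (O : List (Fin n × Fin n)) : Prop :=
  IsColumnSerial O ∨ IsColumnSerial O.reverse ∨ IsRowSerial O ∨ IsRowSerial O.reverse

/-- Generalized serial pivot orderings. -/
def IsGeneralizedSerial {n : ℕ} (O : List (Fin n × Fin n)) : Prop :=
  IsPivotOrdering O ∧
    ∃ O' O'' : List (Fin n × Fin n), IsSerialWithPermutations O'' ∧
      ((PermutationEquivalent O O' ∧ WeakEquivalent O' O'') ∨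
        (WeakEquivalent O O' ∧ PermutationEquivalent O' O''))

/-! ## The element-wise complex `J`-Jacobi method -/

/-- `J = diag(I_ν, -I_{n-ν})`. -/
def signature (n ν : ℕ) : Matrix (Fin n) (Fin n) ℂ :=
  Matrix.diagonal (fun i => if i.val < ν then 1 else -1)

/-- The identity matrix with the `2 × 2` matrix `M` put in rows and columns `i, j`. -/
def embed {n : ℕ} (i j : Fin n) (M : Matrix (Fin 2) (Fin 2) ℂ) : Matrix (Fin n) (Fin n) ℂ :=
  fun r s =>
    if r = i ∧ s = i then M 0 0
    else if r = i ∧ s = j then M 0 1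
    else if r = j ∧ s = i then M 1 0
    else if r = j ∧ s = j then M 1 1
    else if r = s then 1 else 0

/-- `diag(e^{ιφ}, 1)`. -/
noncomputable def phase (φ : ℝ) : Matrix (Fin 2) (Fin 2) ℂ :=
  !![Complex.exp (φ * Complex.I), 0; 0, 1]

/-- The trigonometric rotation. -/
noncomputable def trigRotation (θ : ℝ) : Matrix (Fin 2) (Fin 2) ℂ :=
  !![(Real.cos θ : ℂ), -(Real.sin θ : ℂ); (Real.sin θ : ℂ), (Real.cos θ : ℂ)]

/-- The hyperbolic rotation. -/
noncomputable def hypRotation (θ : ℝ) : Matrix (Fin 2) (Fin 2) ℂ :=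
  !![(Real.cosh θ : ℂ), (Real.sinh θ : ℂ); (Real.sinh θ : ℂ), (Real.cosh θ : ℂ)]

/-- `T` is a pivot submatrix that the method may use on the Hermitian matrix `A` at the pivot
pair `(i, j)`, `i < j`. Here `φ` is an argument of `a_ij`. The rotation is hyperbolic, with
`tanh 2θ = -2|a_ij| / (a_ii + a_jj)`, if `i` belongs to the first `ν` indices and `j` does not.
Otherwise it is trigonometric, with `θ ∈ [-π/4, π/4]` and `tan 2θ = 2|a_ij| / (a_ii - a_jj)`;
this equation is multiplied out, so that `θ = ±π/4` if `a_ii = a_jj` and `a_ij ≠ 0`. Where these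
conditions leave `φ` or `θ` undetermined, every choice is admitted. -/
def IsPivotTransformation {n : ℕ} (ν : ℕ) (A : Matrix (Fin n) (Fin n) ℂ) (i j : Fin n)
    (T : Matrix (Fin 2) (Fin 2) ℂ) : Prop :=
  ∃ φ θ : ℝ, A i j = (‖A i j‖ : ℂ) * Complex.exp (φ * Complex.I) ∧
    ((i.val < ν ∧ ν ≤ j.val ∧
        Real.tanh (2 * θ) = -(2 * ‖A i j‖) / ((A i i).re + (A j j).re) ∧
        T = phase φ * hypRotation θ) ∨
      (¬ (i.val < ν ∧ ν ≤ j.val) ∧ |θ| ≤ Real.pi / 4 ∧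
        2 * ‖A i j‖ * Real.cos (2 * θ) = ((A i i).re - (A j j).re) * Real.sin (2 * θ) ∧
        T = phase φ * trigRotation θ))

/-- The sequence `S` is generated from `A` by the element-wise complex `J`-Jacobi method under
the cyclic pivot strategy that repeats the pivot ordering `O` periodically. -/
def IsJJacobiSequence {n : ℕ} (ν : ℕ) (O : List (Fin n × Fin n))
    (A : Matrix (Fin n) (Fin n) ℂ) (S : ℕ → Matrix (Fin n) (Fin n) ℂ) : Prop :=
  S 0 = A ∧ ∀ k : ℕ, ∃ (i j : Fin n) (T : Matrix (Fin 2) (Fin 2) ℂ),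
    O[k % O.length]? = some (i, j) ∧ IsPivotTransformation ν (S k) i j T ∧
      S (k + 1) = (embed i j T)ᴴ * S k * embed i j T

end JJacobi

namespace JJacobi

/-! ## Calculus of embedded `2 × 2` matrices -/

/-! The proof combines a monotone potential, passage to limits, and a combinatorial statement about
the limits.

Every transformation used is `J`-unitary (`PivotForm.congr_signature`), so positive definiteness and
the polynomial `det (A - x J)` are invariants. Hyperbolic steps lower the trace and trigonometric
steps preserve it; by positive definiteness the trace bounds all entries. With `t` the initial
trace, the potential `∑ (a_rr² - 2 t a_rr)` is bounded above and grows by at least `|a_ij|²` in each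
step (`PivotForm.estimate`). Hence the pivot elements tend to zero.

Let `M` be the length of the ordering. Along an ultrafilter on the cycle number `t`, all the
matrices `S (M t + m)` converge simultaneously, say to `H m`. The invariance of the determinant
keeps each `H m` positive definite, so hyperbolic angles tend to zero and trigonometric rotations
have unitary limits. Thus `H m` and `H (m + 1)` are joined by a `NullStep`: the pivot element is
zero, and the step is unitary with nonzero diagonal; moreover it is diagonal or acts on equal
diagonal elements (`nullStep_of_tendsto`).

It remains to see that sufficiently many cycles of null steps can start only from a diagonal matrix
(`ForcesDiag`). Null steps can be reversed, relabelled, and interchanged when their index sets are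
disjoint, and they fix diagonal matrices. So the property passes through all the relations between
orderings, which reduces the claim to column-serial orderings; there one sweep is enough
(`NullRun.column`).

Consequently all `H m` are one diagonal matrix. Its diagonal is confined to a finite set by the
pencil determinant. Consecutive cycles share their limit along each ultrafilter, so the sequence
cannot keep moving between finitely many candidates (`tendsto_of_finite_clusterPts`). -/

theorem eq_or_ne_and_ne {α : Type*} (a b : α) : a = b ∨ (b ≠ a ∧ a ≠ b) :=
  (eq_or_ne a b).imp_right fun h => ⟨h.symm, h⟩

theorem mul_embed_apply {n : ℕ} {i j : Fin n} (hij : i ≠ j) (A : Matrix (Fin n) (Fin n) ℂ)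
    (U : Matrix (Fin 2) (Fin 2) ℂ) (r s : Fin n) :
    (A * embed i j U) r s =
      if s = i then A r i * U 0 0 + A r j * U 1 0
      else if s = j then A r i * U 0 1 + A r j * U 1 1 else A r s := by
  rw [Matrix.mul_apply]
  split_ifs with h1 h2
  · subst h1
    rw [← Finset.sum_subset (Finset.subset_univ {s, j}), Finset.sum_pair hij]
    · simp [embed, hij.symm, hij]
    · intro x _ hx
      simp only [Finset.mem_insert, Finset.mem_singleton, not_or] at hx
      simp [embed, hx.1, hx.2]
  · subst h2
    rw [← Finset.sum_subset (Finset.subset_univ {i, s}), Finset.sum_pair hij]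
    · simp [embed, hij.symm]
    · intro x _ hx
      simp only [Finset.mem_insert, Finset.mem_singleton, not_or] at hx
      simp [embed, hx.1, hx.2]
  · rw [Finset.sum_eq_single s]
    · simp [embed, h1, h2]
    · intro x _ hx
      simp [embed, h1, h2, hx]
    · simp

theorem conjTranspose_embed {n : ℕ} {i j : Fin n} (hij : i ≠ j) (U : Matrix (Fin 2) (Fin 2) ℂ) :
    (embed i j U)ᴴ = embed i j Uᴴ := by
  ext r s
  have hji := hij.symm
  rw [conjTranspose_apply]
  rcases eq_or_ne_and_ne i r with rfl | ⟨a, a'⟩ <;>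
    [skip; rcases eq_or_ne_and_ne j r with rfl | ⟨b, b'⟩] <;>
    (rcases eq_or_ne_and_ne i s with rfl | ⟨c, c'⟩ <;>
      [skip; rcases eq_or_ne_and_ne j s with rfl | ⟨d, d'⟩]) <;>
    simp [embed, *]
  simp [eq_comm, apply_ite]

theorem embed_mul_apply {n : ℕ} {i j : Fin n} (hij : i ≠ j) (A : Matrix (Fin n) (Fin n) ℂ)
    (U : Matrix (Fin 2) (Fin 2) ℂ) (r s : Fin n) :
    (embed i j U * A) r s =
      if r = i then U 0 0 * A i s + U 0 1 * A j s
      else if r = j then U 1 0 * A i s + U 1 1 * A j s else A r s := by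
  have h : embed i j U * A = (Aᴴ * embed i j Uᴴ)ᴴ := by
    rw [conjTranspose_mul, conjTranspose_conjTranspose, conjTranspose_embed hij,
      conjTranspose_conjTranspose]
  rw [h, conjTranspose_apply, mul_embed_apply hij]
  split_ifs <;> simp [mul_comm]

theorem embed_mul_embed {n : ℕ} {i j : Fin n} (hij : i ≠ j) (U V : Matrix (Fin 2) (Fin 2) ℂ) :
    embed i j U * embed i j V = embed i j (U * V) := by
  ext r s
  have hji := hij.symm
  rw [mul_embed_apply hij]
  rcases eq_or_ne_and_ne i r with rfl | ⟨a, a'⟩ <;>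
    [skip; rcases eq_or_ne_and_ne j r with rfl | ⟨b, b'⟩] <;>
    (rcases eq_or_ne_and_ne i s with rfl | ⟨c, c'⟩ <;>
      [skip; rcases eq_or_ne_and_ne j s with rfl | ⟨d, d'⟩]) <;>
    simp [embed, Matrix.mul_apply, Fin.sum_univ_two, *]

theorem embed_one {n : ℕ} {i j : Fin n} (hij : i ≠ j) :
    embed i j (1 : Matrix (Fin 2) (Fin 2) ℂ) = 1 := by
  have hji := hij.symm
  ext r s
  rcases eq_or_ne_and_ne i r with rfl | ⟨a, a'⟩ <;>
    [skip; rcases eq_or_ne_and_ne j r with rfl | ⟨b, b'⟩] <;>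
    (rcases eq_or_ne_and_ne i s with rfl | ⟨c, c'⟩ <;>
      [skip; rcases eq_or_ne_and_ne j s with rfl | ⟨d, d'⟩]) <;>
    simp [embed, Matrix.one_apply, *]

theorem embed_mul_embed_comm {n : ℕ} {i j i' j' : Fin n} (hij : i ≠ j) (hij' : i' ≠ j')
    (h1 : i ≠ i') (h2 : i ≠ j') (h3 : j ≠ i') (h4 : j ≠ j') (U V : Matrix (Fin 2) (Fin 2) ℂ) :
    embed i j U * embed i' j' V = embed i' j' V * embed i j U := by
  ext r s
  have e := hij.symm
  have e' := hij'.symm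
  have h1' := h1.symm
  have h2' := h2.symm
  have h3' := h3.symm
  have h4' := h4.symm
  rw [mul_embed_apply hij', embed_mul_apply hij']
  rcases eq_or_ne_and_ne i' r with rfl | ⟨a, a'⟩ <;>
    [skip; rcases eq_or_ne_and_ne j' r with rfl | ⟨b, b'⟩] <;>
    (rcases eq_or_ne_and_ne i' s with rfl | ⟨c, c'⟩ <;>
      [skip; rcases eq_or_ne_and_ne j' s with rfl | ⟨d, d'⟩]) <;>
    simp [embed, *]

/-- Entries of a congruence by an embedded matrix. -/
theorem congr_embed_apply {n : ℕ} {i j : Fin n} (hij : i ≠ j) (A : Matrix (Fin n) (Fin n) ℂ)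
    (U : Matrix (Fin 2) (Fin 2) ℂ) (r s : Fin n) :
    ((embed i j U)ᴴ * A * embed i j U) r s =
      if s = i then
        (if r = i then star (U 0 0) * A i i + star (U 1 0) * A j i
          else if r = j then star (U 0 1) * A i i + star (U 1 1) * A j i else A r i) * U 0 0 +
        (if r = i then star (U 0 0) * A i j + star (U 1 0) * A j j
          else if r = j then star (U 0 1) * A i j + star (U 1 1) * A j j else A r j) * U 1 0
      else if s = j then
        (if r = i then star (U 0 0) * A i i + star (U 1 0) * A j i
          else if r = j then star (U 0 1) * A i i + star (U 1 1) * A j i else A r i) * U 0 1 +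
        (if r = i then star (U 0 0) * A i j + star (U 1 0) * A j j
          else if r = j then star (U 0 1) * A i j + star (U 1 1) * A j j else A r j) * U 1 1
      else if r = i then star (U 0 0) * A i s + star (U 1 0) * A j s
      else if r = j then star (U 0 1) * A i s + star (U 1 1) * A j s else A r s := by
  rw [mul_embed_apply hij, conjTranspose_embed hij]
  simp only [embed_mul_apply hij, conjTranspose_apply]

theorem embed_swap {n : ℕ} {i j : Fin n} (hij : i ≠ j) (U : Matrix (Fin 2) (Fin 2) ℂ) :
    embed j i !![U 1 1, U 1 0; U 0 1, U 0 0] = embed i j U := by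
  ext r s
  simp only [embed]
  split_ifs <;> simp_all

theorem embed_submatrix {n : ℕ} (q : Equiv.Perm (Fin n)) (i j : Fin n)
    (U : Matrix (Fin 2) (Fin 2) ℂ) :
    (embed i j U).submatrix q.symm q.symm = embed (q i) (q j) U := by
  ext r s
  simp [embed, Equiv.symm_apply_eq]

/-! ## Steps with zero pivot -/

/-- A limit of Jacobi steps whose pivot elements tend to zero. -/
def NullStep {n : ℕ} (p : Fin n × Fin n) (H K : Matrix (Fin n) (Fin n) ℂ) : Prop :=
  p.1 ≠ p.2 ∧ H.IsHermitian ∧ H p.1 p.2 = 0 ∧ ∃ U : Matrix (Fin 2) (Fin 2) ℂ,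
    Uᴴ * U = 1 ∧ U 0 0 ≠ 0 ∧ U 1 1 ≠ 0 ∧
      ((U 0 1 = 0 ∧ U 1 0 = 0) ∨ H p.1 p.1 = H p.2 p.2) ∧
      K = (embed p.1 p.2 U)ᴴ * H * embed p.1 p.2 U

theorem IsHermitian_zero_comm {n : ℕ} {H : Matrix (Fin n) (Fin n) ℂ} (hH : H.IsHermitian)
    {r s : Fin n} (h : H r s = 0) : H s r = 0 := by
  rw [← hH.apply, h, star_zero]

theorem NullStep.isHermitian {n : ℕ} {p : Fin n × Fin n} {H K : Matrix (Fin n) (Fin n) ℂ}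
    (h : NullStep p H K) : K.IsHermitian := by
  obtain ⟨-, hH, -, U, -, -, -, -, rfl⟩ := h
  exact isHermitian_conjTranspose_mul_mul _ hH

theorem unitary_two_entries {U : Matrix (Fin 2) (Fin 2) ℂ} (hU : Uᴴ * U = 1) :
    star (U 0 0) * U 0 0 + star (U 1 0) * U 1 0 = 1 ∧
    star (U 0 0) * U 0 1 + star (U 1 0) * U 1 1 = 0 ∧
    star (U 0 1) * U 0 0 + star (U 1 1) * U 1 0 = 0 ∧
    star (U 0 1) * U 0 1 + star (U 1 1) * U 1 1 = 1 := by
  have h := fun a b => congrFun (congrFun hU a) b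
  simp only [Matrix.mul_apply, Fin.sum_univ_two, conjTranspose_apply] at h
  exact ⟨by simpa using h 0 0, by simpa using h 0 1, by simpa using h 1 0, by simpa using h 1 1⟩

/-- The pivot block does not change in a step with zero pivot. -/
theorem NullStep.pivot_block {n : ℕ} {p : Fin n × Fin n} {H K : Matrix (Fin n) (Fin n) ℂ}
    (h : NullStep p H K) :
    K p.1 p.2 = 0 ∧ K p.1 p.1 = H p.1 p.1 ∧ K p.2 p.2 = H p.2 p.2 := by
  obtain ⟨hij, hH, h0, U, hU, -, -, hd, rfl⟩ := h
  obtain ⟨u1, u2, u3, u4⟩ := unitary_two_entries hU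
  have h0' := IsHermitian_zero_comm hH h0
  simp only [congr_embed_apply hij, if_true, hij.symm, if_false, h0, h0', mul_zero,
    add_zero, zero_add]
  rcases hd with ⟨a, b⟩ | hd
  · simp only [a, b, star_zero, mul_zero, zero_mul, add_zero, zero_add] at *
    refine ⟨trivial, ?_, ?_⟩
    · linear_combination H p.1 p.1 * u1
    · linear_combination H p.2 p.2 * u4
  · rw [hd]
    refine ⟨?_, ?_, ?_⟩
    · linear_combination H p.2 p.2 * u2
    · linear_combination H p.2 p.2 * u1
    · linear_combination H p.2 p.2 * u4

/-- The inverse step uses `Uᴴ`, which has the same nonvanishing diagonal. The alternative "diagonal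
`U` or equal diagonal elements" survives because the pivot block is unchanged. -/
theorem NullStep.symm {n : ℕ} {p : Fin n × Fin n} {H K : Matrix (Fin n) (Fin n) ℂ}
    (h : NullStep p H K) : NullStep p K H := by
  have hK := h.isHermitian
  obtain ⟨k0, k1, k2⟩ := h.pivot_block
  obtain ⟨hij, hH, h0, U, hU, hu0, hu1, hd, hK'⟩ := h
  have hU' : U * Uᴴ = 1 := mul_eq_one_comm.mp hU
  refine ⟨hij, hK, k0, Uᴴ, by rwa [conjTranspose_conjTranspose], by simpa using hu0,
    by simpa using hu1, ?_, ?_⟩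
  · rw [k1, k2]
    exact hd.imp_left fun hd => ⟨by simp [hd.2], by simp [hd.1]⟩
  · have e : embed p.1 p.2 U * embed p.1 p.2 Uᴴ = 1 := by
      rw [embed_mul_embed hij, hU', embed_one hij]
    rw [hK', conjTranspose_embed hij, conjTranspose_embed hij, conjTranspose_conjTranspose]
    calc H = (embed p.1 p.2 U * embed p.1 p.2 Uᴴ) * H *
          (embed p.1 p.2 U * embed p.1 p.2 Uᴴ) := by rw [e, Matrix.one_mul, Matrix.mul_one]
      _ = _ := by simp only [Matrix.mul_assoc]

/-- Outside the pivot block, the affected entries are combinations of zeros, and the block itself is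
preserved. -/
theorem NullStep.eq_of_isDiag {n : ℕ} {p : Fin n × Fin n} {H K : Matrix (Fin n) (Fin n) ℂ}
    (h : NullStep p H K) (hd : H.IsDiag) : K = H := by
  obtain ⟨k0, k1, k2⟩ := h.pivot_block
  have k0' := IsHermitian_zero_comm h.isHermitian k0
  obtain ⟨hij, hH, h0, U, -, -, -, -, rfl⟩ := h
  have h0' := IsHermitian_zero_comm hH h0
  obtain ⟨i, j⟩ := p
  dsimp only at *
  have hji := hij.symm
  have hd' : ∀ a b, a ≠ b → H a b = 0 := fun a b hab => hd hab
  ext r s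
  rcases eq_or_ne_and_ne i r with rfl | ⟨a, a'⟩ <;>
    [skip; rcases eq_or_ne_and_ne j r with rfl | ⟨b, b'⟩] <;>
    (rcases eq_or_ne_and_ne i s with rfl | ⟨c, c'⟩ <;>
      [skip; rcases eq_or_ne_and_ne j s with rfl | ⟨d, d'⟩]) <;>
    first
    | rw [k1]
    | rw [k2]
    | rw [k0, h0]
    | rw [k0', h0']
    | (rw [congr_embed_apply hij]; simp [*, Ne.symm])

/-- Exchanging `i` and `j` exchanges the two diagonal entries of `U`; this is why a null step
requires both to be nonzero. -/
theorem NullStep.swap {n : ℕ} {i j : Fin n} {H K : Matrix (Fin n) (Fin n) ℂ}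
    (h : NullStep (i, j) H K) : NullStep (j, i) H K := by
  obtain ⟨hij, hH, h0, U, hU, hu0, hu1, hd, rfl⟩ := h
  refine ⟨hij.symm, hH, IsHermitian_zero_comm hH h0, !![U 1 1, U 1 0; U 0 1, U 0 0], ?_,
    by simpa using hu1, by simpa using hu0, ?_, by rw [embed_swap hij]⟩
  · obtain ⟨u1, u2, u3, u4⟩ := unitary_two_entries hU
    ext a b
    fin_cases a <;> fin_cases b <;>
      simp only [Matrix.mul_apply, Fin.sum_univ_two, conjTranspose_apply] <;> simp <;>
      simp only [← Complex.star_def, add_comm, *]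
  · exact hd.imp (fun h => ⟨by simpa using h.2, by simpa using h.1⟩) Eq.symm

theorem NullStep.submatrix {n : ℕ} (q : Equiv.Perm (Fin n)) {p : Fin n × Fin n}
    {H K : Matrix (Fin n) (Fin n) ℂ} (h : NullStep p H K) :
    NullStep (min (q p.1) (q p.2), max (q p.1) (q p.2)) (H.submatrix q.symm q.symm)
      (K.submatrix q.symm q.symm) := by
  have key : NullStep (q p.1, q p.2) (H.submatrix q.symm q.symm) (K.submatrix q.symm q.symm) := by
    obtain ⟨hij, hH, h0, U, hU, hu0, hu1, hd, rfl⟩ := h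
    refine ⟨by simpa using hij, hH.submatrix _, by simpa using h0, U, hU, hu0, hu1,
      by simpa using hd, ?_⟩
    dsimp only
    rw [← embed_submatrix, ← submatrix_mul_equiv _ _ _ q.symm, ← submatrix_mul_equiv _ _ _ q.symm,
      conjTranspose_submatrix]
  rcases le_total (q p.1) (q p.2) with h' | h'
  · rwa [min_eq_left h', max_eq_right h']
  · rw [min_eq_right h', max_eq_left h']
    exact key.swap

/-- For disjoint index sets the embedded matrices commute, and neither step touches the pivot block
of the other, so the conditions on both pivots persist. -/
theorem NullStep.comm {n : ℕ} {p q : Fin n × Fin n}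
    (hpq : Disjoint ({p.1, p.2} : Set (Fin n)) {q.1, q.2})
    {H K L : Matrix (Fin n) (Fin n) ℂ} (h : NullStep p H K) (h' : NullStep q K L) :
    ∃ K', NullStep q H K' ∧ NullStep p K' L := by
  have e : p.1 ≠ q.1 ∧ p.1 ≠ q.2 ∧ p.2 ≠ q.1 ∧ p.2 ≠ q.2 := by
    rw [Set.disjoint_left] at hpq
    refine ⟨?_, ?_, ?_, ?_⟩ <;> intro e
    · exact hpq (Set.mem_insert _ _) (by simp [e])
    · exact hpq (Set.mem_insert _ _) (by simp [e])
    · exact hpq (a := p.2) (by simp) (by simp [e])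
    · exact hpq (a := p.2) (by simp) (by simp [e])
  obtain ⟨e1, e2, e3, e4⟩ := e
  obtain ⟨hij, hH, h0, U, hU, hu0, hu1, hd, rfl⟩ := h
  obtain ⟨hij', hH', h0', V, hV, hv0, hv1, hd', rfl⟩ := h'
  simp only [congr_embed_apply hij, e1.symm, e2.symm, e3.symm, e4.symm, if_false] at h0' hd'
  refine ⟨(embed q.1 q.2 V)ᴴ * H * embed q.1 q.2 V, ⟨hij', hH, h0', V, hV, hv0, hv1, hd', rfl⟩,
    hij, isHermitian_conjTranspose_mul_mul _ hH, ?_, U, hU, hu0, hu1, ?_, ?_⟩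
  · simpa only [congr_embed_apply hij', e1, e2, e3, e4, if_false] using h0
  · simpa only [congr_embed_apply hij', e1, e2, e3, e4, if_false] using hd
  · have c := embed_mul_embed_comm hij hij' e1 e2 e3 e4 U V
    calc _ = (embed p.1 p.2 U * embed q.1 q.2 V)ᴴ * H * (embed p.1 p.2 U * embed q.1 q.2 V) := by
          simp only [conjTranspose_mul, Matrix.mul_assoc]
      _ = _ := by
          rw [c]
          simp only [conjTranspose_mul, Matrix.mul_assoc]

/-! ## Runs of steps with zero pivots -/

/-- `K` arises from `H` by steps with zero pivot along the list. -/
def NullRun {n : ℕ} : List (Fin n × Fin n) → Matrix (Fin n) (Fin n) ℂ →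
    Matrix (Fin n) (Fin n) ℂ → Prop
  | [], H, K => K = H
  | p :: L, H, K => ∃ G, NullStep p H G ∧ NullRun L G K

theorem nullRun_append {n : ℕ} {L₁ L₂ : List (Fin n × Fin n)} {H K : Matrix (Fin n) (Fin n) ℂ} :
    NullRun (L₁ ++ L₂) H K ↔ ∃ G, NullRun L₁ H G ∧ NullRun L₂ G K := by
  induction L₁ generalizing H with
  | nil => simp [NullRun]
  | cons p L ih =>
    simp only [List.cons_append, NullRun, ih]
    constructor
    · rintro ⟨G, h, G', h', h''⟩
      exact ⟨G', ⟨G, h, h'⟩, h''⟩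
    · rintro ⟨G', ⟨G, h, h'⟩, h''⟩
      exact ⟨G, h, G', h', h''⟩

theorem NullRun.reverse {n : ℕ} {L : List (Fin n × Fin n)} {H K : Matrix (Fin n) (Fin n) ℂ}
    (h : NullRun L H K) : NullRun L.reverse K H := by
  induction L generalizing H with
  | nil => exact Eq.symm h
  | cons p L ih =>
    obtain ⟨G, h1, h2⟩ := h
    rw [List.reverse_cons, nullRun_append]
    exact ⟨G, ih h2, H, h1.symm, rfl⟩

theorem NullRun.eq_of_isDiag {n : ℕ} {L : List (Fin n × Fin n)}
    {H K : Matrix (Fin n) (Fin n) ℂ} (h : NullRun L H K) (hd : H.IsDiag) : K = H := by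
  induction L generalizing H with
  | nil => exact h
  | cons p L ih =>
    obtain ⟨G, h1, h2⟩ := h
    obtain rfl := h1.eq_of_isDiag hd
    exact ih h2 hd

/-- A reversed run is a run, and runs fix diagonal matrices. Diagonality anywhere in a run therefore
propagates backwards as well as forwards. -/
theorem NullRun.isDiag_left {n : ℕ} {L : List (Fin n × Fin n)}
    {H K : Matrix (Fin n) (Fin n) ℂ} (h : NullRun L H K) (hd : K.IsDiag) : H.IsDiag := by
  rw [h.reverse.eq_of_isDiag hd]
  exact hd

theorem NullRun.submatrix {n : ℕ} (q : Equiv.Perm (Fin n)) {L : List (Fin n × Fin n)}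
    {H K : Matrix (Fin n) (Fin n) ℂ} (h : NullRun L H K) :
    NullRun (L.map fun p => (min (q p.1) (q p.2), max (q p.1) (q p.2)))
      (H.submatrix q.symm q.symm) (K.submatrix q.symm q.symm) := by
  induction L generalizing H with
  | nil => exact congrArg (fun M : Matrix (Fin n) (Fin n) ℂ => M.submatrix q.symm q.symm) h
  | cons p L ih =>
    obtain ⟨G, h1, h2⟩ := h
    exact ⟨_, h1.submatrix q, ih h2⟩

theorem NullRun.of_admissibleTransposition {n : ℕ} {L L' : List (Fin n × Fin n)}
    (hL : AdmissibleTransposition L L') {H K : Matrix (Fin n) (Fin n) ℂ} (h : NullRun L H K) :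
    NullRun L' H K := by
  obtain ⟨l₁, l₂, p, q, hpq⟩ := hL
  rw [nullRun_append] at h ⊢
  obtain ⟨G, h1, G1, h2, G2, h3, h4⟩ := h
  obtain ⟨G3, h5, h6⟩ := h2.comm hpq h3
  exact ⟨G, h1, G3, h5, G2, h6, h4⟩

theorem NullRun.of_equivalent {n : ℕ} {L L' : List (Fin n × Fin n)}
    (hL : Equivalent L L') {H K : Matrix (Fin n) (Fin n) ℂ} (h : NullRun L H K) :
    NullRun L' H K := by
  induction hL with
  | refl => exact h
  | tail _ hs ih => exact ih.of_admissibleTransposition hs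

/-- `L` repeated `N` times. -/
def cycles {n : ℕ} (N : ℕ) (L : List (Fin n × Fin n)) : List (Fin n × Fin n) :=
  (List.replicate N L).flatten

theorem cycles_succ {n : ℕ} (N : ℕ) (L : List (Fin n × Fin n)) :
    cycles (N + 1) L = L ++ cycles N L := by
  simp [cycles, List.replicate_succ]

theorem NullRun.cycles_of_equivalent {n N : ℕ} {L L' : List (Fin n × Fin n)}
    (hL : Equivalent L L') {H K : Matrix (Fin n) (Fin n) ℂ} (h : NullRun (cycles N L) H K) :
    NullRun (cycles N L') H K := by
  induction N generalizing H with
  | zero => exact h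
  | succ N ih =>
    rw [cycles_succ, nullRun_append] at h ⊢
    obtain ⟨G, h1, h2⟩ := h
    exact ⟨G, h1.of_equivalent hL, ih h2⟩

theorem cycles_shift {n : ℕ} (N : ℕ) (L₁ L₂ : List (Fin n × Fin n)) :
    cycles (N + 1) (L₁ ++ L₂) = L₁ ++ (cycles N (L₂ ++ L₁) ++ L₂) := by
  induction N with
  | zero => simp [cycles]
  | succ N ih => rw [cycles_succ, ih, cycles_succ]; simp

/-- Enough cycles with zero pivots along the list exist for diagonal matrices only. -/
def ForcesDiag {n : ℕ} (L : List (Fin n × Fin n)) : Prop :=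
  ∃ N, ∀ H K : Matrix (Fin n) (Fin n) ℂ, NullRun (cycles N L) H K → H.IsDiag

/-! ### Invariance of the forcing property under the relations between orderings -/

theorem ForcesDiag.of_equivalent {n : ℕ} {L L' : List (Fin n × Fin n)}
    (hL : Equivalent L L') (h : ForcesDiag L') : ForcesDiag L := by
  obtain ⟨N, h⟩ := h
  exact ⟨N, fun H K hr => h H K (hr.cycles_of_equivalent hL)⟩

/-- One extra cycle contains `N` full cycles of the shifted ordering after the prefix `L₁`;
diagonality is then carried back over that prefix. -/
theorem ForcesDiag.of_shiftEquivalent {n : ℕ} {L L' : List (Fin n × Fin n)}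
    (hL : ShiftEquivalent L L') (h : ForcesDiag L') : ForcesDiag L := by
  obtain ⟨L₁, L₂, rfl, rfl⟩ := hL
  obtain ⟨N, h⟩ := h
  refine ⟨N + 1, fun H K hr => ?_⟩
  rw [cycles_shift, nullRun_append] at hr
  obtain ⟨G, h1, h2⟩ := hr
  rw [nullRun_append] at h2
  obtain ⟨G', h2, -⟩ := h2
  exact h1.isDiag_left (h _ _ h2)

theorem ForcesDiag.of_weakEquivalent {n : ℕ} {L L' : List (Fin n × Fin n)}
    (hL : WeakEquivalent L L') (h : ForcesDiag L') : ForcesDiag L := by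
  induction hL with
  | refl => exact h
  | tail _ hs ih =>
    rcases hs with hs | hs
    · exact ih (h.of_equivalent hs)
    · exact ih (h.of_shiftEquivalent hs)

theorem ForcesDiag.of_permutationEquivalent {n : ℕ} {L L' : List (Fin n × Fin n)}
    (hL : PermutationEquivalent L L') (h : ForcesDiag L') : ForcesDiag L := by
  obtain ⟨q, rfl⟩ := hL
  obtain ⟨N, h⟩ := h
  refine ⟨N, fun H K hr => ?_⟩
  have hr := hr.submatrix q
  rw [cycles, List.map_flatten, List.map_replicate] at hr
  have hd := h _ _ hr
  intro r s hrs
  simpa using hd (i := q r) (j := q s) (by simpa using hrs)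

theorem ForcesDiag.of_reverse {n : ℕ} {L : List (Fin n × Fin n)} (h : ForcesDiag L.reverse) :
    ForcesDiag L := by
  obtain ⟨N, h⟩ := h
  refine ⟨N, fun H K hr => ?_⟩
  have hr' := hr.reverse
  rw [cycles, List.reverse_flatten, List.map_replicate, List.reverse_replicate] at hr'
  exact hr.isDiag_left (h _ _ hr')

/-! ## Serial orderings -/

/-- Here `L` holds the rows of column `j` still to be processed. The invariant has three parts: the
indices up to `j` outside `L` are mutually decoupled, so are those in `L`, and a row of `L` with
zero in column `j` vanishes at every index up to `j` outside `L`. When a row becomes the pivot row,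
its zero pivot element therefore clears its whole coupling to the leading block. -/
theorem NullRun.column {n : ℕ} {j : Fin n} {L : List (Fin n)} (hL : L.Nodup)
    (hLj : ∀ i ∈ L, i < j) {H K : Matrix (Fin n) (Fin n) ℂ}
    (h : NullRun (L.map fun i => (i, j)) H K)
    (h1 : ∀ r ≤ j, ∀ s ≤ j, r ∉ L → s ∉ L → r ≠ s → H r s = 0)
    (h2 : ∀ r ∈ L, ∀ s ∈ L, r ≠ s → H r s = 0)
    (h3 : ∀ r ∈ L, ∀ s ≤ j, s ∉ L → H r j = 0 → H r s = 0) :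
    ∀ r ≤ j, ∀ s ≤ j, r ≠ s → K r s = 0 := by
  induction L generalizing H with
  | nil =>
    obtain rfl : K = H := h
    intro r hr s hs
    exact h1 r hr s hs (by simp) (by simp)
  | cons i L ih =>
    obtain ⟨G, hG, hr⟩ := h
    rw [List.nodup_cons] at hL
    have hij : i ≠ j := (hLj i (by simp)).ne
    have hjL : j ∉ L := fun hj => (hLj j (by simp [hj])).false
    have hGH := hG.isHermitian
    have hGij : G i j = 0 := hG.pivot_block.1
    obtain ⟨-, hH, h0, U, -, -, hu1, -, hGe⟩ := hG
    -- Before the rotation, row and column `i` are already decoupled in the leading block, so the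
    -- rotation only spreads column `j` over columns `i` and `j`.
    have hi : ∀ r ≤ j, r ≠ i → H r i = 0 := by
      intro r hr hri
      refine IsHermitian_zero_comm hH ?_
      by_cases hrL : r ∈ L
      · exact h2 i (by simp) r (by simp [hrL]) hri.symm
      · exact h3 i (by simp) r hr (by simp [hrL, hri]) h0
    have e1 : ∀ r s, r ≠ i → r ≠ j → s ≠ i → s ≠ j → G r s = H r s := by
      intro r s a b c d
      rw [hGe, congr_embed_apply hij]
      simp [a, b, c, d]
    have e2 : ∀ r ≤ j, r ≠ i → r ≠ j → G r i = H r j * U 1 0 ∧ G r j = H r j * U 1 1 := by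
      intro r hr a b
      rw [hGe, congr_embed_apply hij, congr_embed_apply hij]
      simp [a, b, hij.symm, hi r hr a]
    refine ih hL.2 (fun a ha => hLj a (by simp [ha])) hr ?_ ?_ ?_
    · have key : ∀ r ≤ j, r ∉ L → r ≠ i → r ≠ j → G r i = 0 ∧ G r j = 0 := by
        intro r hr hrL a b
        have := h1 r hr j le_rfl (by simp [hrL, a]) (by simp [hjL, hij.symm]) b
        simpa [this] using e2 r hr a b
      intro r hr s hs hrL hsL hrs
      rcases eq_or_ne s i with c | c
      · subst c
        rcases eq_or_ne r j with b | b
        · rw [b]; exact IsHermitian_zero_comm hGH hGij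
        · exact (key r hr hrL hrs b).1
      rcases eq_or_ne s j with d | d
      · subst d
        rcases eq_or_ne r i with a | a
        · rw [a]; exact hGij
        · exact (key r hr hrL a hrs).2
      rcases eq_or_ne r i with a | a
      · rw [a]; exact IsHermitian_zero_comm hGH (key s hs hsL c d).1
      rcases eq_or_ne r j with b | b
      · rw [b]; exact IsHermitian_zero_comm hGH (key s hs hsL c d).2
      rw [e1 r s a b c d]
      exact h1 r hr s hs (by simp [hrL, a]) (by simp [hsL, c]) hrs
    · intro r hr s hs hrs
      rw [e1 r s (by rintro rfl; exact hL.1 hr) (by rintro rfl; exact hjL ‹_›)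
        (by rintro rfl; exact hL.1 hs) (by rintro rfl; exact hjL hs)]
      exact h2 r (by simp [hr]) s (by simp [hs]) hrs
    · intro r hrL s hs hsL hrj
      have hr := (hLj r (by simp [hrL])).le
      have a : r ≠ i := by rintro rfl; exact hL.1 hrL
      have b : r ≠ j := by rintro rfl; exact hjL hrL
      have e := e2 r hr a b
      -- The new entry is `H r j * U 1 1`; since `U 1 1 ≠ 0`, a zero after the step comes from a
      -- zero before it.
      have hz : H r j = 0 := by
        rw [hrj] at e
        simpa [hu1] using e.2
      by_cases c : s = i
      · subst c; simp [e.1, hz]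
      by_cases d : s = j
      · subst d; exact hrj
      · rw [e1 r s a b c d]
        exact h3 r (by simp [hrL]) s hs (by simp [hsL, c]) hz

theorem ForcesDiag.of_isColumnSerial {n : ℕ} {L : List (Fin n × Fin n)}
    (hL : IsColumnSerial L) : ForcesDiag L := by
  obtain ⟨τ, hτ, rfl⟩ := hL
  refine ⟨1, fun H K h => ?_⟩
  -- The sweep proves that its end `K` is diagonal; this carries the conclusion back to its start
  -- `H`.
  refine h.isDiag_left ?_
  rw [cycles, List.replicate_one, List.flatten_singleton] at h
  have key : ∀ m ≤ n, ∀ G : Matrix (Fin n) (Fin n) ℂ,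
      NullRun (((List.finRange n).take m).flatMap (fun j => (τ j).map (fun i => (i, j)))) H G →
        ∀ r s : Fin n, r.val < m → s.val < m → r ≠ s → G r s = 0 := by
    intro m
    induction m with
    | zero => intro _ G _ r s hr; omega
    | succ m ih =>
      intro hm G hG
      rw [List.take_add_one, List.flatMap_append, nullRun_append] at hG
      obtain ⟨G', h1, h2⟩ := hG
      have ih := ih (by omega) G' h1
      have hget : (List.finRange n)[m]? = some ⟨m, hm⟩ := by
        rw [List.getElem?_eq_getElem (by simpa using hm)]
        simp
      rw [hget] at h2
      simp only [Option.toList_some, List.flatMap_cons, List.flatMap_nil, List.append_nil] at h2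
      have hmem := (hτ ⟨m, hm⟩).2
      -- At the start of column `m`, the only index up to `m` outside the list is `m` itself, so the
      -- first and third parts of the invariant are trivial; the second is the induction hypothesis.
      have := h2.column (hτ ⟨m, hm⟩).1 (fun i hi => (hmem i).1 hi) ?_ ?_ ?_
      · intro r s hr hs hrs
        exact this r (Nat.lt_succ_iff.mp hr) s (Nat.lt_succ_iff.mp hs) hrs
      · intro r hr s hs hr' hs' hrs
        rw [hmem, not_lt] at hr' hs'
        exact absurd ((le_antisymm hr hr').trans (le_antisymm hs hs').symm) hrs
      · intro r hr s hs hrs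
        exact ih r s ((hmem r).1 hr) ((hmem s).1 hs) hrs
      · intro r _ s hs hs' hz
        rw [hmem, not_lt] at hs'
        rwa [le_antisymm hs hs']
  intro r s hrs
  refine key n le_rfl K ?_ r s r.2 s.2 hrs
  rwa [List.take_of_length_le (by simp)]

/-- Reversing the order of the indices turns rows from the bottom up into columns from the left. -/
theorem ForcesDiag.of_isRowSerial {n : ℕ} {L : List (Fin n × Fin n)}
    (hL : IsRowSerial L) : ForcesDiag L := by
  obtain ⟨τ, hτ, rfl⟩ := hL
  refine ForcesDiag.of_permutationEquivalent ⟨Fin.revPerm, rfl⟩ (of_isColumnSerial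
    ⟨fun j => (τ j.rev).map Fin.rev, fun j => ⟨(hτ _).1.map Fin.rev_injective, fun i => ?_⟩, ?_⟩)
  · rw [List.mem_map]
    constructor
    · rintro ⟨a, ha, rfl⟩
      rw [(hτ _).2] at ha
      rwa [Fin.rev_lt_iff]
    · intro h
      exact ⟨i.rev, by rw [(hτ _).2]; simpa using h, by simp⟩
  · rw [List.finRange_reverse, List.flatMap_map, List.map_flatMap]
    refine List.flatMap_congr fun j _ => ?_
    rw [List.map_map, List.map_map]
    refine List.map_congr_left fun a ha => ?_
    have : a.rev < j := by
      have := ((hτ _).2 a).1 ha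
      rwa [Fin.rev_lt_iff]
    simp [this.le]

theorem IsSerialWithPermutations.forcesDiag {n : ℕ} {L : List (Fin n × Fin n)}
    (hL : IsSerialWithPermutations L) : ForcesDiag L := by
  rcases hL with h | h | h | h
  · exact .of_isColumnSerial h
  · exact .of_reverse (.of_isColumnSerial h)
  · exact .of_isRowSerial h
  · exact .of_reverse (.of_isRowSerial h)

theorem IsGeneralizedSerial.forcesDiag {n : ℕ} {L : List (Fin n × Fin n)}
    (hL : IsGeneralizedSerial L) : ForcesDiag L := by
  obtain ⟨-, O', O'', hs, ⟨h1, h2⟩ | ⟨h1, h2⟩⟩ := hL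
  · exact .of_permutationEquivalent h1 (.of_weakEquivalent h2 hs.forcesDiag)
  · exact .of_weakEquivalent h1 (.of_permutationEquivalent h2 hs.forcesDiag)

/-! ## A single step of the method -/

/-- Common form of the trigonometric (`e = -1`) and the hyperbolic (`e = 1`) transformations. -/
structure PivotForm {n : ℕ} (ν : ℕ) (A : Matrix (Fin n) (Fin n) ℂ) (i j : Fin n)
    (T : Matrix (Fin 2) (Fin 2) ℂ) (w : ℂ) (e c s : ℝ) : Prop where
  star_mul_self : star w * w = 1
  entry : A i j = (‖A i j‖ : ℂ) * w
  det_eq : c ^ 2 - e * s ^ 2 = 1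
  eq_matrix : T = !![w * c, w * (e * s : ℝ); (s : ℂ), (c : ℂ)]
  annihilate : e * c * s * (A i i).re + ‖A i j‖ * (c ^ 2 + e * s ^ 2) + c * s * (A j j).re = 0
  cases : (e = 1 ∧ i.val < ν ∧ ν ≤ j.val ∧ 1 ≤ c) ∨
    (e = -1 ∧ ¬ (i.val < ν ∧ ν ≤ j.val) ∧ 0 ≤ c ∧ 1 / 2 ≤ c ^ 2)

theorem star_exp_ofReal_mul_I (φ : ℝ) :
    star (Complex.exp (φ * Complex.I)) * Complex.exp (φ * Complex.I) = 1 := by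
  rw [Complex.star_def, ← Complex.exp_conj, ← Complex.exp_add]
  simp

theorem IsPivotTransformation.exists_pivotForm {n ν : ℕ} {A : Matrix (Fin n) (Fin n) ℂ}
    (hA : A.PosDef) {i j : Fin n} {T : Matrix (Fin 2) (Fin 2) ℂ}
    (h : IsPivotTransformation ν A i j T) : ∃ w e c s, PivotForm ν A i j T w e c s := by
  obtain ⟨φ, θ, hφ, ⟨h1, h2, hθ, rfl⟩ | ⟨hn, hθ, hq, rfl⟩⟩ := h
  · have hi : 0 < (A i i).re := (Complex.lt_def.mp (hA.diag_pos (i := i))).1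
    have hj : 0 < (A j j).re := (Complex.lt_def.mp (hA.diag_pos (i := j))).1
    refine ⟨_, 1, Real.cosh θ, Real.sinh θ, star_exp_ofReal_mul_I φ, hφ, ?_, ?_, ?_,
      .inl ⟨rfl, h1, h2, Real.one_le_cosh θ⟩⟩
    · linarith [Real.cosh_sq θ]
    · simp [phase, hypRotation]
    · rw [Real.tanh_eq_sinh_div_cosh, div_eq_div_iff (Real.cosh_pos _).ne' (by positivity),
        Real.sinh_two_mul, Real.cosh_two_mul] at hθ
      linear_combination hθ / 2
  · have hpi := Real.pi_pos
    have hc : Real.cos (Real.pi / 4) ≤ Real.cos θ := by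
      rw [← Real.cos_abs θ]
      exact Real.cos_le_cos_of_nonneg_of_le_pi (abs_nonneg _) (by linarith) hθ
    rw [Real.cos_pi_div_four] at hc
    have h2 : 0 ≤ √2 / 2 := by positivity
    refine ⟨_, -1, Real.cos θ, Real.sin θ, star_exp_ofReal_mul_I φ, hφ, ?_, ?_, ?_,
      .inr ⟨rfl, hn, h2.trans hc, ?_⟩⟩
    · linarith [Real.sin_sq_add_cos_sq θ]
    · simp [phase, trigRotation]
    · rw [Real.sin_two_mul, Real.cos_two_mul'] at hq
      linear_combination hq / 2
    · have := pow_le_pow_left₀ h2 hc 2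
      rw [div_pow, Real.sq_sqrt (by norm_num)] at this
      linarith

theorem PivotForm.e_sq {n ν : ℕ} {A : Matrix (Fin n) (Fin n) ℂ} {i j : Fin n}
    {T : Matrix (Fin 2) (Fin 2) ℂ} {w : ℂ} {e c s : ℝ} (h : PivotForm ν A i j T w e c s) :
    e * e = 1 := by
  rcases h.cases with ⟨h, -⟩ | ⟨h, -⟩ <;> simp [h]

/-- The transformations of the method are `J`-unitary. -/
theorem PivotForm.congr_signature {n ν : ℕ} {A : Matrix (Fin n) (Fin n) ℂ} {i j : Fin n}
    (hij : i < j) {T : Matrix (Fin 2) (Fin 2) ℂ} {w : ℂ} {e c s : ℝ}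
    (h : PivotForm ν A i j T w e c s) :
    (embed i j T)ᴴ * signature n ν * embed i j T = signature n ν := by
  -- The hyperbolic case (`e = 1`) is exactly the case of opposite signs in `J`.
  have hs : (signature n ν) i i = -e * (signature n ν) j j := by
    simp only [signature, diagonal_apply_eq]
    rcases h.cases with ⟨he, h1, h2, -⟩ | ⟨he, hn, -⟩
    · simp [he, h1, h2.not_gt]
    · have : i.val < j.val := hij
      by_cases h1 : j.val < ν
      · simp [he, h1, h1.trans' this]
      · have : ¬ i.val < ν := fun h => hn ⟨h, not_lt.mp h1⟩
        simp [he, h1, this]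
  have hz : ∀ r t, r ≠ t → (signature n ν) r t = 0 := fun r t hrt => diagonal_apply_ne _ hrt
  have hne := hij.ne
  have hne' := hij.ne'
  have hw := h.star_mul_self
  have he : (e : ℂ) * e = 1 := by exact_mod_cast h.e_sq
  have hd : (c : ℂ) ^ 2 - e * (s : ℂ) ^ 2 = 1 := by exact_mod_cast h.det_eq
  rw [h.eq_matrix]
  rw [Complex.star_def] at hw
  ext r t
  rcases eq_or_ne_and_ne i r with rfl | ⟨a, a'⟩ <;>
    [skip; rcases eq_or_ne_and_ne j r with rfl | ⟨b, b'⟩] <;>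
    (rcases eq_or_ne_and_ne i t with rfl | ⟨x, x'⟩ <;>
      [skip; rcases eq_or_ne_and_ne j t with rfl | ⟨y, y'⟩]) <;>
    rw [congr_embed_apply hne] <;>
    simp [*]
  · linear_combination (-(e : ℂ) * c ^ 2 * signature n ν j j) * hw +
      (-(e : ℂ) * signature n ν j j) * hd - s ^ 2 * signature n ν j j * he
  · linear_combination (-(e : ℂ) * e * c * s * signature n ν j j) * hw -
      c * s * signature n ν j j * he
  · linear_combination (-(e : ℂ) * e * c * s * signature n ν j j) * hw -
      c * s * signature n ν j j * he
  · linear_combination (-(e : ℂ) * e * e * s ^ 2 * signature n ν j j) * hw +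
      (signature n ν j j) * hd - e * s ^ 2 * signature n ν j j * he

/-! ### Invariants of `J`-unitary congruences -/

theorem det_signature_ne_zero (n ν : ℕ) : (signature n ν).det ≠ 0 := by
  rw [signature, det_diagonal, Finset.prod_ne_zero_iff]
  intro i _
  split_ifs <;> norm_num

theorem star_det_mul_det_of_congr {n ν : ℕ} {E : Matrix (Fin n) (Fin n) ℂ}
    (h : Eᴴ * signature n ν * E = signature n ν) : star E.det * E.det = 1 := by
  have h := congrArg det h
  rw [det_mul, det_mul, det_conjTranspose] at h
  apply mul_right_cancel₀ (det_signature_ne_zero n ν)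
  linear_combination h

theorem posDef_congr {n ν : ℕ} {A E : Matrix (Fin n) (Fin n) ℂ}
    (h : Eᴴ * signature n ν * E = signature n ν) (hA : A.PosDef) : (Eᴴ * A * E).PosDef := by
  refine hA.conjTranspose_mul_mul_same (mulVec_injective_of_isUnit ?_)
  rw [isUnit_iff_isUnit_det]
  exact IsUnit.of_mul_eq_one_right _ (star_det_mul_det_of_congr h)

theorem det_congr_sub {n ν : ℕ} {A E : Matrix (Fin n) (Fin n) ℂ}
    (h : Eᴴ * signature n ν * E = signature n ν) (x : ℂ) :
    (Eᴴ * A * E - x • signature n ν).det = (A - x • signature n ν).det := by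
  have : Eᴴ * A * E - x • signature n ν = Eᴴ * (A - x • signature n ν) * E := by
    rw [Matrix.mul_sub, Matrix.sub_mul, Matrix.mul_smul, Matrix.smul_mul, h]
  rw [this, det_mul, det_mul, det_conjTranspose]
  linear_combination (A - x • signature n ν).det * star_det_mul_det_of_congr h

/-! ### Trace and potential in one step -/

theorem PivotForm.re_diag {n ν : ℕ} {A : Matrix (Fin n) (Fin n) ℂ} (hA : A.IsHermitian)
    {i j : Fin n} (hij : i ≠ j) {T : Matrix (Fin 2) (Fin 2) ℂ} {w : ℂ} {e c s : ℝ}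
    (h : PivotForm ν A i j T w e c s) :
    (((embed i j T)ᴴ * A * embed i j T) i i).re =
      c ^ 2 * (A i i).re + 2 * c * s * ‖A i j‖ + s ^ 2 * (A j j).re ∧
    (((embed i j T)ᴴ * A * embed i j T) j j).re =
      s ^ 2 * (A i i).re + 2 * e * c * s * ‖A i j‖ + c ^ 2 * (A j j).re := by
  have hii : A i i = ((A i i).re : ℂ) := (hA.coe_re_apply_self i).symm
  have hjj : A j j = ((A j j).re : ℂ) := (hA.coe_re_apply_self j).symm
  have hji : A j i = (‖A i j‖ : ℂ) * star w := by
    rw [← hA.apply]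
    conv_lhs => rw [h.entry]
    simp
  have hent := h.entry
  set ρ := ‖A i j‖
  set α := (A i i).re
  set β := (A j j).re
  have hw := h.star_mul_self
  have he : (e : ℂ) * e = 1 := by exact_mod_cast h.e_sq
  rw [Complex.star_def] at hw hji
  constructor
  · rw [← Complex.ofReal_re (c ^ 2 * _ + _ + _)]
    congr 1
    rw [congr_embed_apply hij, h.eq_matrix]
    simp [hji, hent, hii, hjj]
    linear_combination (2 * c * s * ρ + α * c ^ 2 : ℂ) * hw
  · rw [← Complex.ofReal_re (s ^ 2 * _ + _ + _)]
    congr 1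
    rw [congr_embed_apply hij, h.eq_matrix]
    simp [hij.symm, hji, hent, hii, hjj]
    linear_combination (2 * e * c * s * ρ + α * e * e * s ^ 2 : ℂ) * hw + α * s ^ 2 * he

/-- Both diagonal elements drop by the same `δ ≥ 0`, and `ρ² = S δ - δ²` with `S = α + β`. The sum
of squares alone changes by `-2 S δ + 2 δ²`, which may be negative; the trace term adds `4 t δ ≥ 4 S
δ` and compensates. -/
theorem hyperbolic_estimate {α β ρ c s t : ℝ} (hα : 0 < α) (hβ : 0 < β) (hd : c ^ 2 - s ^ 2 = 1)
    (h : c * s * α + ρ * (c ^ 2 + s ^ 2) + c * s * β = 0) (ht : α + β ≤ t) :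
    (c ^ 2 * α + 2 * c * s * ρ + s ^ 2 * β) + (s ^ 2 * α + 2 * c * s * ρ + c ^ 2 * β) ≤ α + β ∧
    ρ ^ 2 ≤ (c ^ 2 * α + 2 * c * s * ρ + s ^ 2 * β) ^ 2 +
        (s ^ 2 * α + 2 * c * s * ρ + c ^ 2 * β) ^ 2 - α ^ 2 - β ^ 2 +
      2 * t * (α + β - ((c ^ 2 * α + 2 * c * s * ρ + s ^ 2 * β) +
        (s ^ 2 * α + 2 * c * s * ρ + c ^ 2 * β))) := by
  obtain ⟨δ, hδ⟩ : ∃ δ, δ = -(s ^ 2 * (α + β) + 2 * c * s * ρ) := ⟨_, rfl⟩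
  have e1 : c ^ 2 * α + 2 * c * s * ρ + s ^ 2 * β = α - δ := by
    rw [hδ]; linear_combination α * hd
  have e2 : s ^ 2 * α + 2 * c * s * ρ + c ^ 2 * β = β - δ := by
    rw [hδ]; linear_combination β * hd
  rw [e1, e2]
  obtain ⟨S, hS⟩ : ∃ S, S = α + β := ⟨_, rfl⟩
  have hS0 : 0 < S := by linarith
  have hC : 1 ≤ c ^ 2 + s ^ 2 := by nlinarith [sq_nonneg s]
  -- The new diagonal sum is `S / cosh 2θ`, since `c² + s² = cosh 2θ`.
  have h1 : (S - 2 * δ) * (c ^ 2 + s ^ 2) = S := by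
    rw [hδ, hS]
    linear_combination 4 * c * s * h + (α + β) * (1 - 2 * s ^ 2) * hd
  have hpos : 0 < S - 2 * δ := by
    by_contra hneg
    nlinarith
  have hδ0 : 0 ≤ δ := by nlinarith
  have h2 : S ^ 2 - (S - 2 * δ) ^ 2 = 4 * ρ ^ 2 := by
    have hC2 : (c ^ 2 + s ^ 2) ^ 2 ≠ 0 := by positivity
    apply mul_right_cancel₀ hC2
    have h3 : ρ * (c ^ 2 + s ^ 2) = -(c * s * S) := by rw [hS]; linear_combination h
    have h4 : (c ^ 2 + s ^ 2) ^ 2 = 1 + 4 * (c * s) ^ 2 := by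
      linear_combination (c ^ 2 - s ^ 2 + 1) * hd
    calc (S ^ 2 - (S - 2 * δ) ^ 2) * (c ^ 2 + s ^ 2) ^ 2
        = S ^ 2 * (c ^ 2 + s ^ 2) ^ 2 - ((S - 2 * δ) * (c ^ 2 + s ^ 2)) ^ 2 := by ring
      _ = 4 * (-(c * s * S)) ^ 2 := by rw [h1, h4]; ring
      _ = 4 * ρ ^ 2 * (c ^ 2 + s ^ 2) ^ 2 := by rw [← h3]; ring
  refine ⟨by linarith, ?_⟩
  have h5 : S * δ ≤ t * δ := by gcongr; linarith
  have h6 : ρ ^ 2 = S * δ - δ ^ 2 := by linarith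
  have h7 : (α - δ) ^ 2 + (β - δ) ^ 2 - α ^ 2 - β ^ 2 = -2 * (S * δ) + 2 * δ ^ 2 := by
    rw [hS]; ring
  have h8 : 0 ≤ S * δ := by positivity
  nlinarith [sq_nonneg δ]

/-- A rotation preserves the trace and Frobenius norm of the pivot block, and annihilation moves the
weight `2 ρ²` onto the diagonal. -/
theorem trigonometric_estimate {α β ρ c s : ℝ} (hd : c ^ 2 + s ^ 2 = 1)
    (h : -(c * s * α) + ρ * (c ^ 2 - s ^ 2) + c * s * β = 0) :
    (c ^ 2 * α + 2 * c * s * ρ + s ^ 2 * β) + (s ^ 2 * α - 2 * c * s * ρ + c ^ 2 * β) = α + β ∧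
    (c ^ 2 * α + 2 * c * s * ρ + s ^ 2 * β) ^ 2 + (s ^ 2 * α - 2 * c * s * ρ + c ^ 2 * β) ^ 2 =
      α ^ 2 + β ^ 2 + 2 * ρ ^ 2 := by
  refine ⟨by linear_combination (α + β) * hd, ?_⟩
  linear_combination (α ^ 2 + β ^ 2 + 2 * ρ ^ 2) * (c ^ 2 + s ^ 2 + 1) * hd -
    2 * (-(c * s * α) + ρ * (c ^ 2 - s ^ 2) + c * s * β) * h

/-- Real part of the trace. -/
noncomputable def traceRe {n : ℕ} (A : Matrix (Fin n) (Fin n) ℂ) : ℝ := ∑ r, (A r r).re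

/-- The sum of the squares of the diagonal minus `2 t` times the trace. -/
noncomputable def potential {n : ℕ} (t : ℝ) (A : Matrix (Fin n) (Fin n) ℂ) : ℝ :=
  ∑ r, ((A r r).re ^ 2 - 2 * t * (A r r).re)

theorem sum_eq_of_eq_off_pair {n : ℕ} {i j : Fin n} (hij : i ≠ j) {f g : Fin n → ℝ}
    (h : ∀ r, r ≠ i → r ≠ j → f r = g r) :
    ∑ r, f r = ∑ r, g r + ((f i - g i) + (f j - g j)) := by
  rw [← sub_eq_iff_eq_add', ← Finset.sum_sub_distrib,
    ← Finset.sum_subset (Finset.subset_univ {i, j}), Finset.sum_pair hij]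
  intro x _ hx
  simp only [Finset.mem_insert, Finset.mem_singleton, not_or] at hx
  rw [h x hx.1 hx.2, sub_self]

theorem _root_.Matrix.PosDef.re_diag_pos {n : ℕ} {A : Matrix (Fin n) (Fin n) ℂ} (hA : A.PosDef)
    (i : Fin n) : 0 < (A i i).re :=
  (Complex.lt_def.mp (hA.diag_pos (i := i))).1

theorem PivotForm.estimate {n ν : ℕ} {A : Matrix (Fin n) (Fin n) ℂ} (hA : A.PosDef)
    {i j : Fin n} (hij : i ≠ j) {T : Matrix (Fin 2) (Fin 2) ℂ} {w : ℂ} {e c s : ℝ}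
    (h : PivotForm ν A i j T w e c s) {t : ℝ} (ht : traceRe A ≤ t) :
    traceRe ((embed i j T)ᴴ * A * embed i j T) ≤ traceRe A ∧
    ‖A i j‖ ^ 2 ≤ potential t ((embed i j T)ᴴ * A * embed i j T) - potential t A := by
  have hoff : ∀ r, r ≠ i → r ≠ j → ((embed i j T)ᴴ * A * embed i j T) r r = A r r := by
    intro r hr hr'
    rw [congr_embed_apply hij]
    simp [hr, hr']
  obtain ⟨hi, hj⟩ := h.re_diag hA.isHermitian hij
  have hα := hA.re_diag_pos i
  have hβ := hA.re_diag_pos j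
  have hαβ : (A i i).re + (A j j).re ≤ t := by
    refine le_trans ?_ ht
    rw [traceRe, ← Finset.sum_pair (f := fun r => (A r r).re) hij]
    exact Finset.sum_le_sum_of_subset_of_nonneg (Finset.subset_univ _)
      fun r _ _ => (hA.re_diag_pos r).le
  have htr : traceRe ((embed i j T)ᴴ * A * embed i j T) = traceRe A + _ :=
    sum_eq_of_eq_off_pair hij fun r hr hr' => by rw [hoff r hr hr']
  have hpo : potential t ((embed i j T)ᴴ * A * embed i j T) = potential t A + _ :=
    sum_eq_of_eq_off_pair hij fun r hr hr' => by rw [hoff r hr hr']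
  rw [htr, hpo, hi, hj]
  have hd := h.det_eq
  have ha := h.annihilate
  rcases h.cases with ⟨rfl, -⟩ | ⟨rfl, -⟩
  · obtain ⟨h1, h2⟩ := hyperbolic_estimate (ρ := ‖A i j‖) (c := c) (s := s) hα hβ (by linarith)
      (by linear_combination ha) hαβ
    constructor
    · linear_combination h1
    · linear_combination h2
  · obtain ⟨h1, h2⟩ := trigonometric_estimate (α := (A i i).re) (β := (A j j).re)
      (ρ := ‖A i j‖) (c := c) (s := s) (by linarith) (by linear_combination ha)
    have h3 := sq_nonneg ‖A i j‖
    constructor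
    · linear_combination h1
    · linear_combination h3 - h2 + 2 * t * h1

theorem _root_.Matrix.PosDef.norm_apply_le_traceRe {n : ℕ} {A : Matrix (Fin n) (Fin n) ℂ}
    (hA : A.PosDef) (r s : Fin n) : ‖A r s‖ ≤ traceRe A := by
  -- Semidefiniteness is used for the `2 × 2` minor because `r = s` is allowed, where the minor is
  -- singular.
  have h := (hA.posSemidef.submatrix ![r, s]).det_nonneg
  rw [det_fin_two] at h
  simp only [submatrix_apply, cons_val_zero, cons_val_one] at h
  have hr := hA.re_diag_pos r
  have hs := hA.re_diag_pos s
  have key : ∀ q, (A q q).re ≤ traceRe A := fun q =>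
    Finset.single_le_sum (f := fun r => (A r r).re) (fun q _ => (hA.re_diag_pos q).le)
      (Finset.mem_univ q)
  have h1 : A r r * A s s - A r s * A s r =
      (((A r r).re * (A s s).re - ‖A r s‖ ^ 2 : ℝ) : ℂ) := by
    rw [← hA.isHermitian.apply s r, Complex.star_def, Complex.mul_conj,
      ← hA.isHermitian.coe_re_apply_self r, ← hA.isHermitian.coe_re_apply_self s,
      Complex.normSq_eq_norm_sq]
    simp
  rw [h1] at h
  have h2 : 0 ≤ (A r r).re * (A s s).re - ‖A r s‖ ^ 2 := by exact_mod_cast h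
  have h3 := key r
  have h4 := key s
  refine le_of_sq_le_sq ?_ (hr.le.trans h3)
  nlinarith

/-! ## Limits of steps -/

theorem exists_ultrafilter_tendsto {ι E : Type*} [NormedAddCommGroup E] [ProperSpace E]
    (𝒰 : Ultrafilter ι) (f : ι → E) (C : ℝ) (h : ∀ t, ‖f t‖ ≤ C) :
    ∃ x, Tendsto f 𝒰 (𝓝 x) := by
  obtain ⟨x, -, hx⟩ := (isCompact_closedBall (0 : E) C).ultrafilter_le_nhds (𝒰.map f)
    (tendsto_principal.mpr (Eventually.of_forall fun t => by simpa using h t) :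
      Tendsto f 𝒰 (𝓟 (Metric.closedBall 0 C)))
  exact ⟨x, hx⟩

theorem continuous_embed {n : ℕ} (i j : Fin n) : Continuous (embed i j) := by
  refine continuous_matrix fun r s => ?_
  unfold embed
  split_ifs <;> fun_prop

theorem tendsto_pivot_matrix {ι : Type*} {l : Filter ι} {w : ι → ℂ} {c s : ι → ℝ} {W : ℂ}
    {C S : ℝ} (hw : Tendsto w l (𝓝 W)) (hc : Tendsto c l (𝓝 C)) (hs : Tendsto s l (𝓝 S)) (e : ℝ) :
    Tendsto (fun t => !![w t * c t, w t * (e * s t : ℝ); (s t : ℂ), (c t : ℂ)]) l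
      (𝓝 !![W * C, W * (e * S : ℝ); (S : ℂ), (C : ℂ)]) := by
  have hc' := (Complex.continuous_ofReal.tendsto _).comp hc
  have hs' := (Complex.continuous_ofReal.tendsto _).comp hs
  have hes := (Complex.continuous_ofReal.tendsto _).comp (hs.const_mul e)
  refine tendsto_pi_nhds.mpr fun a => tendsto_pi_nhds.mpr fun b => ?_
  fin_cases a <;> fin_cases b
  · exact hw.mul hc'
  · exact hw.mul hes
  · exact hs'
  · exact hc'

/-- Eliminating the angle gives `(c s)² = ρ² / (σ² - 4 ρ²)`, and `c² ≥ 1` yields `s² ≤ (c s)²`. The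
positive limit of `σ` keeps the denominator away from zero. -/
theorem tendsto_zero_of_hyperbolic {ι : Type*} {l : Filter ι} {c s ρ σ : ι → ℝ} {L : ℝ}
    (hd : ∀ t, c t ^ 2 - s t ^ 2 = 1) (hσ : ∀ t, 0 < σ t)
    (h : ∀ t, c t * s t * σ t + ρ t * (c t ^ 2 + s t ^ 2) = 0)
    (hρ : Tendsto ρ l (𝓝 0)) (hl : Tendsto σ l (𝓝 L)) (h0 : 0 < L) : Tendsto s l (𝓝 0) := by
  have key : ∀ t, (c t * s t) ^ 2 = ρ t ^ 2 / (σ t ^ 2 - 4 * ρ t ^ 2) := by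
    intro t
    have e : (c t * s t) ^ 2 * (σ t ^ 2 - 4 * ρ t ^ 2) = ρ t ^ 2 := by
      linear_combination (c t * s t * σ t - ρ t * (c t ^ 2 + s t ^ 2)) * h t +
        ρ t ^ 2 * (c t ^ 2 - s t ^ 2 + 1) * hd t
    have hne : σ t ^ 2 - 4 * ρ t ^ 2 ≠ 0 := by
      intro hz
      rw [hz, mul_zero] at e
      have := hσ t
      nlinarith
    rw [eq_div_iff hne, e]
  have h1 : Tendsto (fun t => (c t * s t) ^ 2) l (𝓝 0) := by
    have := (hρ.pow 2).div ((hl.pow 2).sub ((hρ.pow 2).const_mul 4)) (by simp [h0.ne'])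
    rw [funext key]
    rwa [show (0 : ℝ) ^ 2 / (L ^ 2 - 4 * 0 ^ 2) = 0 by simp] at this
  have h2 : Tendsto (fun t => s t ^ 2) l (𝓝 0) :=
    squeeze_zero (fun t => sq_nonneg _)
      (fun t => by rw [mul_pow]; nlinarith [hd t, sq_nonneg (s t)]) h1
  have h3 := h2.sqrt
  simp only [Real.sqrt_sq_eq_abs, Real.sqrt_zero] at h3
  exact (tendsto_zero_iff_abs_tendsto_zero _).mpr h3

theorem conjTranspose_mul_self_pivot_matrix {W : ℂ} (hW : star W * W = 1) {C S : ℝ}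
    (h : C ^ 2 + S ^ 2 = 1) :
    (!![W * C, W * (-S : ℝ); (S : ℂ), (C : ℂ)])ᴴ * !![W * C, W * (-S : ℝ); (S : ℂ), (C : ℂ)] =
      1 := by
  have h' : (C : ℂ) ^ 2 + (S : ℂ) ^ 2 = 1 := by exact_mod_cast h
  rw [Complex.star_def] at hW
  ext a b
  fin_cases a <;> fin_cases b <;> simp [Matrix.mul_apply, Fin.sum_univ_two]
  · linear_combination (C : ℂ) ^ 2 * hW + h'
  · linear_combination -(C : ℂ) * S * hW
  · linear_combination -(C : ℂ) * S * hW
  · linear_combination (S : ℂ) ^ 2 * hW + h'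

theorem norm_eq_one_of_star_mul_self {w : ℂ} (h : star w * w = 1) : ‖w‖ = 1 := by
  have := congrArg norm h
  rw [norm_mul, norm_star, norm_one] at this
  nlinarith [norm_nonneg w]

theorem tendsto_re_apply {n : ℕ} {ι : Type*} {l : Filter ι} {B : ι → Matrix (Fin n) (Fin n) ℂ}
    {H : Matrix (Fin n) (Fin n) ℂ} (h : Tendsto B l (𝓝 H)) (r s : Fin n) :
    Tendsto (fun t => (B t r s).re) l (𝓝 (H r s).re) :=
  (Complex.continuous_re.tendsto _).comp ((h.apply_nhds r).apply_nhds s)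

/-- Steps whose pivots tend to zero converge to a step with zero pivot. -/
theorem nullStep_of_tendsto {n ν : ℕ} {i j : Fin n} (hij : i < j) {ι : Type*}
    (𝒰 : Ultrafilter ι) {B : ι → Matrix (Fin n) (Fin n) ℂ} {T : ι → Matrix (Fin 2) (Fin 2) ℂ}
    (hB : ∀ t, (B t).PosDef) (hT : ∀ t, IsPivotTransformation ν (B t) i j (T t))
    {H K : Matrix (Fin n) (Fin n) ℂ} (hH : H.PosDef) (hl : Tendsto B 𝒰 (𝓝 H))
    (hl' : Tendsto (fun t => (embed i j (T t))ᴴ * B t * embed i j (T t)) 𝒰 (𝓝 K))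
    (hp : Tendsto (fun t => ‖B t i j‖) 𝒰 (𝓝 0)) : NullStep (i, j) H K := by
  choose w e c s hf using fun t => (hT t).exists_pivotForm (hB t)
  obtain ⟨W, hW⟩ := exists_ultrafilter_tendsto 𝒰 w 1
    fun t => (norm_eq_one_of_star_mul_self (hf t).star_mul_self).le
  have hW1 : star W * W = 1 := by
    refine tendsto_nhds_unique (hW.star.mul hW) ?_
    simp only [(hf _).star_mul_self]
    exact tendsto_const_nhds
  have hHij : H i j = 0 := by
    refine tendsto_nhds_unique ((hl.apply_nhds i).apply_nhds j) ?_
    exact tendsto_zero_iff_norm_tendsto_zero.mpr hp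
  have hαl := tendsto_re_apply hl i i
  have hβl := tendsto_re_apply hl j j
  -- Both kinds of step have a limit of trigonometric form: in the hyperbolic case `C = 1` and `S =
  -- 0`, so `e₀ * S = -S` holds there too.
  obtain ⟨e₀, C, S, he, hC, hS, hCS, hC0, heS, hor⟩ : ∃ e₀ C S : ℝ, (∀ t, e t = e₀) ∧
      Tendsto c 𝒰 (𝓝 C) ∧ Tendsto s 𝒰 (𝓝 S) ∧ C ^ 2 + S ^ 2 = 1 ∧ C ≠ 0 ∧ e₀ * S = -S ∧
      (S = 0 ∨ H i i = H j j) := by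
    by_cases hyp : i.val < ν ∧ ν ≤ j.val
    · have hcase : ∀ t, e t = 1 ∧ 1 ≤ c t := fun t => by
        rcases (hf t).cases with ⟨h1, -, -, h2⟩ | ⟨-, h, -⟩
        · exact ⟨h1, h2⟩
        · exact absurd hyp h
      have hd : ∀ t, c t ^ 2 - s t ^ 2 = 1 := fun t => by
        have := (hf t).det_eq
        rwa [(hcase t).1, one_mul] at this
      have hs : Tendsto s 𝒰 (𝓝 0) := by
        refine tendsto_zero_of_hyperbolic hd
          (fun t => add_pos ((hB t).re_diag_pos i) ((hB t).re_diag_pos j)) (fun t => ?_) hp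
          (hαl.add hβl) (add_pos (hH.re_diag_pos i) (hH.re_diag_pos j))
        have := (hf t).annihilate
        rw [(hcase t).1] at this
        linarith
      refine ⟨1, 1, 0, fun t => (hcase t).1, ?_, hs, by simp, one_ne_zero, by simp, .inl rfl⟩
      have hc : c = fun t => √(1 + s t ^ 2) := by
        funext t
        rw [← hd t, sub_add_cancel, Real.sqrt_sq (zero_le_one.trans (hcase t).2)]
      rw [hc]
      simpa using ((hs.pow 2).const_add 1).sqrt
    · have hcase : ∀ t, e t = -1 ∧ 0 ≤ c t ∧ 1 / 2 ≤ c t ^ 2 := fun t => by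
        rcases (hf t).cases with ⟨-, h1, h2, -⟩ | ⟨h1, -, h2⟩
        · exact absurd ⟨h1, h2⟩ hyp
        · exact ⟨h1, h2⟩
      have hd : ∀ t, c t ^ 2 + s t ^ 2 = 1 := fun t => by
        have := (hf t).det_eq
        rw [(hcase t).1] at this
        linarith
      obtain ⟨C, hC⟩ := exists_ultrafilter_tendsto 𝒰 c 1 fun t => by
        rw [Real.norm_eq_abs, ← sq_le_one_iff_abs_le_one]; nlinarith [hd t, sq_nonneg (s t)]
      obtain ⟨S, hS⟩ := exists_ultrafilter_tendsto 𝒰 s 1 fun t => by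
        rw [Real.norm_eq_abs, ← sq_le_one_iff_abs_le_one]; nlinarith [hd t, sq_nonneg (c t)]
      -- The restriction `|θ| ≤ π/4` enters here: it keeps the diagonal of the limiting rotation
      -- nonzero.
      have hC2 : 1 / 2 ≤ C ^ 2 := ge_of_tendsto' (hC.pow 2) fun t => (hcase t).2.2
      have hC0 : C ≠ 0 := by rintro rfl; norm_num at hC2
      refine ⟨-1, C, S, fun t => (hcase t).1, hC, hS, ?_, hC0, by ring, ?_⟩
      · refine tendsto_nhds_unique ((hC.pow 2).add (hS.pow 2)) ?_
        simp only [hd]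
        exact tendsto_const_nhds
      · have hz : -(C * S * (H i i).re) + 0 * (C ^ 2 - S ^ 2) + C * S * (H j j).re = 0 := by
          refine tendsto_nhds_unique ((((hC.mul hS).mul hαl).neg.add
            (hp.mul ((hC.pow 2).sub (hS.pow 2)))).add ((hC.mul hS).mul hβl)) ?_
          refine tendsto_const_nhds.congr fun t => ?_
          have := (hf t).annihilate
          rw [(hcase t).1] at this
          linear_combination -this
        have hz' : C * (S * ((H j j).re - (H i i).re)) = 0 := by linear_combination hz
        rcases mul_eq_zero.mp ((mul_eq_zero.mp hz').resolve_left hC0) with h | h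
        · exact .inl h
        · right
          rw [← hH.isHermitian.coe_re_apply_self i, ← hH.isHermitian.coe_re_apply_self j]
          congr 1
          exact (sub_eq_zero.mp h).symm
  have hTl := tendsto_pivot_matrix hW hC hS e₀
  rw [heS] at hTl
  have hTe : (fun t => !![w t * c t, w t * (e₀ * s t : ℝ); (s t : ℂ), (c t : ℂ)]) = T :=
    funext fun t => by rw [(hf t).eq_matrix, he]
  rw [hTe] at hTl
  have hE := ((continuous_embed i j).tendsto _).comp hTl
  have hW0 : W ≠ 0 := by rintro rfl; simp at hW1
  refine ⟨hij.ne, hH.isHermitian, hHij, _, conjTranspose_mul_self_pivot_matrix hW1 hCS,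
    by simpa using ⟨hW0, hC0⟩, by simpa using hC0, hor.imp_left fun h => by simp [h], ?_⟩
  have hE' := (continuous_id.matrix_conjTranspose.tendsto _).comp hE
  exact tendsto_nhds_unique hl' ((hE'.mul hl).mul hE)

/-- A limit of positive definite matrices is semidefinite; the constant nonzero determinant excludes
singularity. -/
theorem posDef_of_tendsto {n : ℕ} {ι : Type*} {l : Filter ι} [l.NeBot]
    {B : ι → Matrix (Fin n) (Fin n) ℂ} (hB : ∀ t, (B t).PosDef) {δ : ℂ} (hδ : δ ≠ 0)
    (hdet : ∀ t, (B t).det = δ) {H : Matrix (Fin n) (Fin n) ℂ} (hl : Tendsto B l (𝓝 H)) :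
    H.PosDef := by
  have hH : H.PosSemidef := by
    refine PosSemidef.of_dotProduct_mulVec_nonneg ?_ fun x => ?_
    · have hc : Continuous fun M : Matrix (Fin n) (Fin n) ℂ => Mᴴ := by fun_prop
      refine tendsto_nhds_unique ((hc.tendsto _).comp hl) ?_
      simpa only [Function.comp_def, (hB _).isHermitian.eq] using hl
    · have hc : Continuous fun M : Matrix (Fin n) (Fin n) ℂ => star x ⬝ᵥ M *ᵥ x := by fun_prop
      exact ge_of_tendsto' ((hc.tendsto _).comp hl)
        fun t => (hB t).posSemidef.dotProduct_mulVec_nonneg x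
  rw [hH.posDef_iff_det_ne_zero]
  have hc : Continuous fun M : Matrix (Fin n) (Fin n) ℂ => M.det := by fun_prop
  have : H.det = δ := by
    refine tendsto_nhds_unique ((hc.tendsto _).comp hl) ?_
    simp only [Function.comp_def, hdet]
    exact tendsto_const_nhds
  rwa [this]

theorem exists_ultrafilter_tendsto_matrix {n : ℕ} {ι : Type*} (𝒰 : Ultrafilter ι)
    (B : ι → Matrix (Fin n) (Fin n) ℂ) (C : ℝ) (h : ∀ t r s, ‖B t r s‖ ≤ C) :
    ∃ H, Tendsto B 𝒰 (𝓝 H) := by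
  choose H hH using fun r s => exists_ultrafilter_tendsto 𝒰 (fun t => B t r s) C fun t => h t r s
  exact ⟨H, tendsto_pi_nhds.mpr fun r => tendsto_pi_nhds.mpr fun s => hH r s⟩

/-! ## Runs along a cyclic strategy -/

theorem nullRun_of_forall {n : ℕ} (L : List (Fin n × Fin n)) (a : ℕ)
    (H : ℕ → Matrix (Fin n) (Fin n) ℂ)
    (h : ∀ m p, L[m]? = some p → NullStep p (H (a + m)) (H (a + m + 1))) :
    NullRun L (H a) (H (a + L.length)) := by
  induction L generalizing a with
  | nil => rfl
  | cons p L ih =>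
    refine ⟨H (a + 1), h 0 p rfl, ?_⟩
    have := ih (a + 1) fun m q hq => by
      have := h (m + 1) q (by simpa using hq)
      rwa [← Nat.add_assoc, Nat.add_right_comm a m 1] at this
    rwa [Nat.add_assoc, Nat.add_comm 1] at this

theorem nullRun_cycles {n : ℕ} {L : List (Fin n × Fin n)} (N a : ℕ)
    (H : ℕ → Matrix (Fin n) (Fin n) ℂ)
    (h : ∀ m p, L[m % L.length]? = some p → NullStep p (H m) (H (m + 1))) :
    NullRun (cycles N L) (H (L.length * a)) (H (L.length * (a + N))) := by
  induction N generalizing a with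
  | zero => rfl
  | succ N ih =>
    rw [cycles_succ, nullRun_append]
    refine ⟨H (L.length * (a + 1)), ?_, ?_⟩
    · refine nullRun_of_forall L _ H fun m p hp => h _ p ?_
      obtain ⟨hm, -⟩ := List.getElem?_eq_some_iff.mp hp
      rwa [Nat.mul_add_mod, Nat.mod_eq_of_lt hm]
    · rw [Nat.add_comm N 1, ← Nat.add_assoc]
      exact ih (a + 1)

/-! ## Convergence -/

/-- Eventually `x t` and `x (t + 1)` are both within `ε` of one point of `F`. Distinct points are at
least `3 ε` apart, so the pairs at `t` and `t + 1`, which overlap in `x (t + 1)`, select the same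
point. -/
theorem tendsto_of_finite_clusterPts {E : Type*} [MetricSpace E] {x : ℕ → E} {F : Set E}
    (hF : F.Finite)
    (hx : ∀ 𝒰 : Ultrafilter ℕ, ↑𝒰 ≤ (atTop : Filter ℕ) → ∃ y ∈ F, Tendsto x 𝒰 (𝓝 y) ∧
      Tendsto (fun t => x (t + 1)) 𝒰 (𝓝 y)) :
    ∃ y ∈ F, Tendsto x atTop (𝓝 y) := by
  obtain ⟨ε, hε, hsep⟩ : ∃ ε > 0, ∀ y ∈ F, ∀ z ∈ F, dist y z < 3 * ε → y = z := by
    by_cases hn : F.Nontrivial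
    · refine ⟨F.infsep / 3, div_pos (hF.infsep_pos_iff_nontrivial.mpr hn) (by norm_num), ?_⟩
      intro y hy z hz h
      by_contra hne
      have := Set.infsep_le_dist_of_mem hy hz hne
      linarith
    · rw [Set.not_nontrivial_iff] at hn
      exact ⟨1, one_pos, fun y hy z hz _ => hn hy hz⟩
  have hev : ∀ᶠ t in atTop, ∃ y ∈ F, dist (x t) y < ε ∧ dist (x (t + 1)) y < ε := by
    refine Filter.mem_iff_ultrafilter.mpr fun 𝒰 h𝒰 => ?_
    obtain ⟨y, hy, h1, h2⟩ := hx 𝒰 h𝒰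
    filter_upwards [h1 (Metric.ball_mem_nhds y hε), h2 (Metric.ball_mem_nhds y hε)] with t ht ht'
    exact ⟨y, hy, ht, ht'⟩
  obtain ⟨N, hN⟩ := eventually_atTop.mp hev
  obtain ⟨y, hy, hyN, -⟩ := hN N le_rfl
  have hstay : ∀ t ≥ N, dist (x t) y < ε := by
    intro t ht
    induction t, ht using Nat.le_induction with
    | base => exact hyN
    | succ t ht ih =>
      obtain ⟨z, hz, h1, h2⟩ := hN t ht
      have : z = y := hsep z hz y hy (by linarith [dist_triangle_left z y (x t)])
      rwa [← this]
  refine ⟨y, hy, (tendsto_iff_ultrafilter _ _ _).mpr fun 𝒰 h𝒰 => ?_⟩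
  obtain ⟨z, hz, h1, -⟩ := hx 𝒰 h𝒰
  have hle : dist z y ≤ ε :=
    le_of_tendsto (h1.dist tendsto_const_nhds) (h𝒰 (eventually_atTop.mpr ⟨N, fun t ht =>
      (hstay t ht).le⟩))
  rwa [← hsep z hz y hy (by linarith)]

theorem tendsto_atTop_of_residues {α : Type*} {f : ℕ → α} {l : Filter α} {M : ℕ} (hM : 0 < M)
    (h : ∀ m, Tendsto (fun t => f (M * t + m)) atTop l) : Tendsto f atTop l := by
  intro s hs
  have h1 : ∀ᶠ t in atTop, ∀ m ∈ Finset.range M, f (M * t + m) ∈ s :=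
    (Finset.eventually_all (Finset.range M)).mpr fun m _ => h m hs
  change ∀ᶠ k in atTop, f k ∈ s
  filter_upwards [(Nat.tendsto_div_const_atTop hM.ne').eventually h1] with k hk
  have := hk (k % M) (Finset.mem_range.mpr (Nat.mod_lt k hM))
  rwa [Nat.div_add_mod] at this

/-- Finitely many real diagonals share the pencil determinant of `(A, J)`. -/
theorem finite_setOf_pencil_det {n : ℕ} (ν : ℕ) (g : ℂ → ℂ) :
    {d : Fin n → ℝ | ∀ x : ℂ, g x = ∏ i, ((d i : ℂ) - x * signature n ν i i)}.Finite := by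
  rcases Set.eq_empty_or_nonempty
    {d : Fin n → ℝ | ∀ x : ℂ, g x = ∏ i, ((d i : ℂ) - x * signature n ν i i)} with h | ⟨d₀, h₀⟩
  · rw [h]; exact Set.finite_empty
  have hsq : ∀ i, signature n ν i i = 1 ∨ signature n ν i i = -1 := fun i => by
    simp only [signature, diagonal_apply_eq]
    split_ifs <;> simp
  refine (Set.Finite.pi fun _ : Fin n => ((Set.finite_range d₀).union
    (Set.finite_range fun r => -d₀ r))).subset fun d hd i _ => ?_
  -- At `x = d i * J_ii` the factor of index `i` vanishes because `J_ii² = 1`; some factor belonging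
  -- to `d₀` then vanishes, whence `d i = ± d₀ r`.
  have hz := (h₀ (d i * signature n ν i i)).symm.trans (hd _)
  rw [Finset.prod_eq_zero (i := i) (f := fun r => (d r : ℂ) - _) (Finset.mem_univ i)] at hz
  · obtain ⟨r, -, hr⟩ := Finset.prod_eq_zero_iff.mp hz
    have hr' : ((d i : ℝ) : ℂ) = (d₀ r : ℝ) ∨ ((d i : ℝ) : ℂ) = ((-d₀ r : ℝ) : ℂ) := by
      push_cast
      rcases hsq i with h | h <;> rcases hsq r with h' | h' <;> rw [h, h'] at hr
      · left; linear_combination -hr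
      · right; linear_combination hr
      · right; linear_combination hr
      · left; linear_combination -hr
    rcases hr' with h | h
    · exact .inl ⟨r, (Complex.ofReal_injective h).symm⟩
    · exact .inr ⟨r, (Complex.ofReal_injective h).symm⟩
  · rcases hsq i with h | h <;> rw [h] <;> ring

/-- Matrices, pivots and invariants of a sequence generated by the method. -/
structure JacobiData {n : ℕ} (ν : ℕ) (O : List (Fin n × Fin n)) (A : Matrix (Fin n) (Fin n) ℂ)
    (S : ℕ → Matrix (Fin n) (Fin n) ℂ) (i j : ℕ → Fin n)
    (T : ℕ → Matrix (Fin 2) (Fin 2) ℂ) : Prop where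
  pivot : ∀ k, O[k % O.length]? = some (i k, j k)
  pivot_lt : ∀ k, i k < j k
  posDef : ∀ k, (S k).PosDef
  transformation : ∀ k, IsPivotTransformation ν (S k) (i k) (j k) (T k)
  step : ∀ k, S (k + 1) = (embed (i k) (j k) (T k))ᴴ * S k * embed (i k) (j k) (T k)
  traceRe_le : ∀ k, traceRe (S k) ≤ traceRe A
  det_sub : ∀ k (x : ℂ), (S k - x • signature n ν).det = (A - x • signature n ν).det
  tendsto_pivot : Tendsto (fun k => ‖S k (i k) (j k)‖) atTop (𝓝 0)

theorem IsJJacobiSequence.exists_jacobiData {n ν : ℕ} {O : List (Fin n × Fin n)}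
    (hO : IsPivotOrdering O) {A : Matrix (Fin n) (Fin n) ℂ} (hA : A.PosDef)
    {S : ℕ → Matrix (Fin n) (Fin n) ℂ} (hS : IsJJacobiSequence ν O A S) :
    ∃ i j T, JacobiData ν O A S i j T := by
  obtain ⟨h0, hS⟩ := hS
  choose i j T hp hT hstep using hS
  have hlt : ∀ k, i k < j k := fun k => (hO.2 (i k, j k)).mp (List.mem_of_getElem? (hp k))
  have hmain : ∀ k, (S k).PosDef ∧ traceRe (S k) ≤ traceRe A ∧
      ∀ x : ℂ, (S k - x • signature n ν).det = (A - x • signature n ν).det := by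
    intro k
    induction k with
    | zero => rw [h0]; exact ⟨hA, le_rfl, fun _ => rfl⟩
    | succ k ih =>
      obtain ⟨h1, h2, h3⟩ := ih
      obtain ⟨w, e, c, s, hf⟩ := (hT k).exists_pivotForm h1
      have hJ := hf.congr_signature (hlt k)
      rw [hstep]
      exact ⟨posDef_congr hJ h1, (hf.estimate h1 (hlt k).ne le_rfl).1.trans h2,
        fun x => (det_congr_sub hJ x).trans (h3 x)⟩
  have hpot : ∀ k, ‖S k (i k) (j k)‖ ^ 2 ≤
      potential (traceRe A) (S (k + 1)) - potential (traceRe A) (S k) := fun k => by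
    obtain ⟨h1, h2, -⟩ := hmain k
    obtain ⟨w, e, c, s, hf⟩ := (hT k).exists_pivotForm h1
    rw [hstep]
    exact (hf.estimate h1 (hlt k).ne h2).2
  have hmono : Monotone fun k => potential (traceRe A) (S k) :=
    monotone_nat_of_le_succ fun k => by linarith [hpot k, sq_nonneg ‖S k (i k) (j k)‖]
  have hbdd : BddAbove (Set.range fun k => potential (traceRe A) (S k)) := by
    -- Each diagonal element lies between `0` and `traceRe A`, so this crude bound suffices.
    refine ⟨∑ _r : Fin n, traceRe A ^ 2, ?_⟩
    rintro _ ⟨k, rfl⟩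
    refine Finset.sum_le_sum fun r _ => ?_
    obtain ⟨h1, h2, -⟩ := hmain k
    have hr := h1.re_diag_pos r
    nlinarith [Complex.re_le_norm (S k r r), h1.norm_apply_le_traceRe r r]
  have hlim := tendsto_atTop_ciSup hmono hbdd
  have hdiff := (hlim.comp (tendsto_add_atTop_nat 1)).sub hlim
  rw [sub_self] at hdiff
  have hsq : Tendsto (fun k => ‖S k (i k) (j k)‖ ^ 2) atTop (𝓝 0) :=
    squeeze_zero (fun _ => sq_nonneg _) hpot hdiff
  have hsqrt := hsq.sqrt
  simp only [Real.sqrt_sq (norm_nonneg _), Real.sqrt_zero] at hsqrt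
  exact ⟨i, j, T, hp, hlt, fun k => (hmain k).1, hT, hstep, fun k => (hmain k).2.1,
    fun k => (hmain k).2.2, hsqrt⟩

theorem JacobiData.length_pos {n ν : ℕ} {O : List (Fin n × Fin n)}
    {A : Matrix (Fin n) (Fin n) ℂ} {S : ℕ → Matrix (Fin n) (Fin n) ℂ} {i j : ℕ → Fin n}
    {T : ℕ → Matrix (Fin 2) (Fin 2) ℂ} (h : JacobiData ν O A S i j T) : 0 < O.length :=
  List.length_pos_of_mem (List.mem_of_getElem? (h.pivot 0))

/-- Along every ultrafilter, all matrices in a window of the sequence have one diagonal limit. -/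
theorem JacobiData.exists_isDiag_limit {n ν : ℕ} {O : List (Fin n × Fin n)}
    {A : Matrix (Fin n) (Fin n) ℂ} {S : ℕ → Matrix (Fin n) (Fin n) ℂ} {i j : ℕ → Fin n}
    {T : ℕ → Matrix (Fin 2) (Fin 2) ℂ} (h : JacobiData ν O A S i j T) (hO : ForcesDiag O)
    (hA : A.det ≠ 0) (𝒰 : Ultrafilter ℕ) (h𝒰 : ↑𝒰 ≤ (atTop : Filter ℕ)) :
    ∃ H : Matrix (Fin n) (Fin n) ℂ, H.IsDiag ∧ H.IsHermitian ∧
      ∀ m, Tendsto (fun t => S (O.length * t + m)) 𝒰 (𝓝 H) := by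
  choose H hH using fun m => exists_ultrafilter_tendsto_matrix 𝒰
    (fun t => S (O.length * t + m)) (traceRe A)
    fun t r s => ((h.posDef _).norm_apply_le_traceRe r s).trans (h.traceRe_le _)
  have hpd : ∀ m, (H m).PosDef := fun m =>
    -- The pencil determinant at `x = 0` is the determinant itself.
    posDef_of_tendsto (fun t => h.posDef (O.length * t + m)) hA
      (fun t => by simpa using h.det_sub (O.length * t + m) 0) (hH m)
  have hstep : ∀ m p, O[m % O.length]? = some p → NullStep p (H m) (H (m + 1)) := by
    intro m p hp
    have hp' : ∀ t, (i (O.length * t + m), j (O.length * t + m)) = p := fun t => by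
      have := h.pivot (O.length * t + m)
      rw [Nat.mul_add_mod, hp] at this
      exact (Option.some.inj this).symm
    have hi : ∀ t, i (O.length * t + m) = p.1 := fun t => congrArg Prod.fst (hp' t)
    have hj : ∀ t, j (O.length * t + m) = p.2 := fun t => congrArg Prod.snd (hp' t)
    have hlt := h.pivot_lt (O.length * 0 + m)
    rw [hi, hj] at hlt
    refine nullStep_of_tendsto (ν := ν) hlt 𝒰 (B := fun t => S (O.length * t + m))
      (T := fun t => T (O.length * t + m)) (fun t => h.posDef _) (fun t => ?_) (hpd m) (hH m) ?_ ?_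
    · have := h.transformation (O.length * t + m)
      rwa [hi, hj] at this
    · refine (hH (m + 1)).congr fun t => ?_
      have := h.step (O.length * t + m)
      rwa [hi, hj] at this
    · have htop : Tendsto (fun t => O.length * t + m) atTop atTop :=
        tendsto_atTop_mono (fun t => (Nat.le_mul_of_pos_left t h.length_pos).trans
          (Nat.le_add_right _ _)) tendsto_id
      refine ((h.tendsto_pivot.comp htop).mono_left h𝒰).congr fun t => ?_
      simp only [Function.comp_apply, hi, hj]
  obtain ⟨N, hN⟩ := hO
  have hdiag : (H 0).IsDiag := by
    have := nullRun_cycles N 0 H hstep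
    exact hN _ _ this
  have heq : ∀ m, H m = H 0 := by
    intro m
    induction m with
    | zero => rfl
    | succ m ih =>
      have hlen := Nat.mod_lt m h.length_pos
      have := (hstep m _ (List.getElem?_eq_getElem hlen)).eq_of_isDiag (ih ▸ hdiag)
      rw [this, ih]
  exact ⟨H 0, hdiag, (hpd 0).isHermitian, fun m => heq m ▸ hH m⟩

theorem isDiag_eq_diagonal_re {n : ℕ} {H : Matrix (Fin n) (Fin n) ℂ} (hd : H.IsDiag)
    (hH : H.IsHermitian) : H = diagonal fun r => ((H r r).re : ℂ) := by
  conv_lhs => rw [← hd.diagonal_diag]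
  congr 1
  funext r
  exact (hH.coe_re_apply_self r).symm

end JJacobi

open JJacobi in
theorem mainTheorem8 (n ν : ℕ) (hν : 1 ≤ ν) (hνn : ν < n)
    (O : List (Fin n × Fin n)) (hO : JJacobi.IsGeneralizedSerial O)
    (A : Matrix (Fin n) (Fin n) ℂ) (hA : A.PosDef)
    (S : ℕ → Matrix (Fin n) (Fin n) ℂ) (hS : JJacobi.IsJJacobiSequence ν O A S) :
    ∃ d : Fin n → ℝ,
      Tendsto S atTop (𝓝 (Matrix.diagonal (fun i => (d i : ℂ)))) ∧
        ∀ x : ℂ, (A - x • JJacobi.signature n ν).det =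
          ∏ i, ((d i : ℂ) - x * JJacobi.signature n ν i i) := by
  obtain ⟨i, j, T, h⟩ := hS.exists_jacobiData hO.1 hA
  have hlim := h.exists_isDiag_limit hO.forcesDiag hA.det_pos.ne'
  obtain ⟨d, hdF, hd⟩ := tendsto_of_finite_clusterPts
    (x := fun t r => (S (O.length * t) r r).re)
    (finite_setOf_pencil_det ν fun x => (A - x • signature n ν).det) fun 𝒰 h𝒰 => by
      obtain ⟨H, hHd, hHh, hH⟩ := hlim 𝒰 h𝒰
      refine ⟨fun r => (H r r).re, fun x => ?_, ?_, ?_⟩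
      · have hc : Continuous fun M : Matrix (Fin n) (Fin n) ℂ => (M - x • signature n ν).det := by
          fun_prop
        have h1 : (A - x • signature n ν).det = (H - x • signature n ν).det := by
          refine tendsto_nhds_unique ?_ ((hc.tendsto _).comp (hH 0))
          simp only [Function.comp_def, h.det_sub]
          exact tendsto_const_nhds
        rw [h1, isDiag_eq_diagonal_re hHd hHh, signature, ← diagonal_smul, diagonal_sub,
          det_diagonal]
        simp
      · exact tendsto_pi_nhds.mpr fun r => tendsto_re_apply (hH 0) r r
      -- Shifting by a full cycle, `m = O.length`, is the passage from `t` to `t + 1`.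
      · exact tendsto_pi_nhds.mpr fun r => tendsto_re_apply (hH O.length) r r
  refine ⟨d, tendsto_atTop_of_residues h.length_pos fun m => ?_, hdF⟩
  refine (tendsto_iff_ultrafilter _ _ _).mpr fun 𝒰 h𝒰 => ?_
  obtain ⟨H, hHd, hHh, hH⟩ := hlim 𝒰 h𝒰
  have hdH : d = fun r => (H r r).re :=
    tendsto_nhds_unique (hd.mono_left h𝒰)
      (tendsto_pi_nhds.mpr fun r => tendsto_re_apply (hH 0) r r)
  rw [hdH, ← isDiag_eq_diagonal_re hHd hHh]
  exact hH m
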